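/- Digraphs are finite and simple: they have no loops, and for any two distinct vertices $x,y$ each of the edges $xy$ and $yx$ may be present (at most once each). For a digraph $G$ let $\delta(G)=\min_{v\in V(G)}\bigl(d^-(v)+d^+(v)\bigr)$ be its minimum total degree, and let $\vec T_s$ be the transitive tournament on $s$ vertices, i.e. the digraph on $\{1,\dots,s\}$ whose edges are the pairs $ij$ with $i<j$. A factor of $G$ is a set of pairwise vertex-disjoint (not necessarily induced) subgraphs of $G$, called tiles, which together cover $V(G)$; a $\vec T_s$-factor is a factor all of whose tiles are isomorphic to $\vec T_s$. Let $s\ge 1$ and $k\ge 0$ be integers. Every digraph $G$ on $n=sk$ vertices with $$\delta(G)\ \ge\ 2\Bigl(1-\frac1s\Bigr)n-1$$ has a $\vec T_s$-factor, consisting of $k$ vertex-disjoint transitive tournaments on $s$ vertices. (For $k=0$ the digraph is empty and the claim is trivial.) The bound is optimal: for all integers $s\ge 2$ and $k\ge 1$ there is a digraph $G$ on $n=sk$ vertices with $\delta(G)=2\bigl(1-\frac1s\bigr)n-2$ which has no $\vec T_s$-factor, and indeed no factor all of whose tiles are tournaments on $s$ vertices. -/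

import Mathlib

namespace Digraph

/-- A digraph is simple if it has no loops. (The pairs `xy` and `yx` may both be edges; multiple
edges in the same direction do not exist for `Digraph`.) -/
def IsSimple {V : Type*} (G : Digraph V) : Prop :=
  ∀ v, ¬ G.Adj v v

/-- The out-degree of a vertex. -/
noncomputable def outDegree {V : Type*} (G : Digraph V) (v : V) : ℕ :=
  Set.ncard {w | G.Adj v w}

/-- The in-degree of a vertex. -/
noncomputable def inDegree {V : Type*} (G : Digraph V) (v : V) : ℕ :=
  Set.ncard {w | G.Adj w v}

/-- The total degree of a vertex. -/
noncomputable def totalDegree {V : Type*} (G : Digraph V) (v : V) : ℕ :=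
  G.inDegree v + G.outDegree v

/-- The minimum total degree `δ(G)`; it is `0` if there are no vertices. -/
noncomputable def minTotalDegree {V : Type*} (G : Digraph V) : ℕ :=
  ⨅ v, G.totalDegree v

/-- A (not necessarily induced, not necessarily spanning) subgraph of a digraph. -/
@[ext]
structure Subgraph {V : Type*} (G : Digraph V) where
  /-- The vertices of the subgraph. -/
  verts : Set V
  /-- The edges of the subgraph. -/
  Adj : V → V → Prop
  adj_sub : ∀ {v w : V}, Adj v w → G.Adj v w
  fst_mem : ∀ {v w : V}, Adj v w → v ∈ verts
  snd_mem : ∀ {v w : V}, Adj v w → w ∈ verts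

/-- A subgraph, viewed as a digraph on its own vertex set. -/
def Subgraph.coe {V : Type*} {G : Digraph V} (T : G.Subgraph) : Digraph T.verts where
  Adj v w := T.Adj v w

/-- Two digraphs are isomorphic. -/
def IsIsomorphic {V W : Type*} (G : Digraph V) (H : Digraph W) : Prop :=
  Nonempty (G.Adj ≃r H.Adj)

/-- A factor of `G`: a set of pairwise vertex-disjoint subgraphs (the tiles) whose union
spans `G`. -/
def IsFactor {V : Type*} (G : Digraph V) (F : Set G.Subgraph) : Prop :=
  F.Pairwise (fun S T => Disjoint S.verts T.verts) ∧ ∀ v : V, ∃ T ∈ F, v ∈ T.verts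

/-- An `H`-factor of `G`: a factor of `G` each of whose tiles is a copy of `H`. -/
def IsFactorOf {V W : Type*} (G : Digraph V) (H : Digraph W) (F : Set G.Subgraph) : Prop :=
  G.IsFactor F ∧ ∀ T ∈ F, T.coe.IsIsomorphic H

/-- A tournament: there are no loops, and any two distinct vertices are joined by an edge in
exactly one of the two directions. -/
def IsTournament {V : Type*} (G : Digraph V) : Prop :=
  G.IsSimple ∧ ∀ v w, v ≠ w → Xor (G.Adj v w) (G.Adj w v)

/-- The transitive tournament on `s` vertices. -/
def transitiveTournament (s : ℕ) : Digraph (Fin s) where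
  Adj i j := i < j

end Digraph

/-!
The tiling problem is restated as an equitable colouring problem for the complement. Let `D` be the
digraph of reversed non-edges of `G`. A set of vertices carries a transitive tournament of `G` if
and only if it contains no directed cycle of `D`, and the degree condition on `G` says that all
total degrees of `D` are at most `2k - 1`. So the claim is that such a `D` on `sk` vertices has a
partition into `k` acyclic sets of size `s` (`exists_isEquitable`). The proof adapts the argument of
Kierstead and Kostochka for the Hajnal–Szemerédi theorem.

By induction one may remove all edges at one vertex `u`, colour, and then move `u` to a class to
which it sends at most one edge. This gives a nearly equitable colouring: one small class `p` of
size `s - 1`, one large class of size `s + 1`. A class can move to another one if some vertex of it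
can be added there without creating a cycle. If the large class reaches `p` by such moves, shifting
vertices along a path finishes the proof (`exists_shift`). Otherwise let `a` be the number of classes
reaching `p`, let `b = k - a`, and let `B` be the set of vertices in the other classes. A vertex of
`B` is blocked by every reachable class, hence sends at least two edges to it and has degree at most
`2b - 1` inside `B`. So `B` minus a vertex can be recoloured by induction on the number of colours.

Choose a minimal nonempty set `T` of reachable classes separated from `p` by a single class
(`exists_cutSet_terminal`). No class of `T` is needed by the other reachable classes. A vertex `z` of
`W ∈ T` is solo if some `y ∈ B` can replace it in `W`. If a solo vertex can move to another reachable
class, the colouring can be made equitable (`IsNearlyEquitable.exists_of_move`). If not, a double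
count of edges between `W` and `B` shows `#T > b` (`IsNearlyEquitable.card_compl_lt`). The slack of
one in the degree bound would spoil this count; it is absorbed by discarding edges that cannot lie
on a cycle (`sum_relevant_le`). If after exchanging `z` for `y` another vertex of `B` becomes movable
to `W`, then `z` fits into a recoloured class of `B` and the number of reachable classes grows
(`IsNearlyEquitable.exists_of_exchange`). If no exchange of this kind exists, then vertices of `B`
sharing a unique in- or out-neighbour in `W` are joined by prescribed edges, and counting over a
maximal subset of `B` without 2-cycles gives a contradiction (`false_of_no_exchange`).

For the sharpness, take the complete digraph and delete all edges inside a set of `k + 1` vertices: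
every tournament meets this set at most once, and a factor has only `k` tiles.
-/

namespace EquitableAcyclic

open Finset
open scoped Classical

universe u v

/-! ### Acyclic sets and degrees -/

section Acyclic

variable {V : Type u} {κ : Type v} {D : V → V → Prop}

/-- The relation `D` has no directed cycle inside the finite set `S`. This is encoded as: every
nonempty subset of `S` has a vertex without in-neighbours in that subset. In particular there are
no loops at vertices of `S`. -/
def AcyclicOn (D : V → V → Prop) (S : Finset V) : Prop :=
  ∀ T ⊆ S, T.Nonempty → ∃ v ∈ T, ∀ w ∈ T, ¬ D w v

/-- The number of edges of `D` between the vertex `v` and the set `S`, in both directions. -/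
noncomputable def degreeTo (D : V → V → Prop) (v : V) (S : Finset V) : ℕ :=
  #{w ∈ S | D w v} + #{w ∈ S | D v w}

theorem AcyclicOn.mono {S T : Finset V} (h : AcyclicOn D T) (hST : S ⊆ T) : AcyclicOn D S :=
  fun R hR hne => h R (hR.trans hST) hne

theorem AcyclicOn.anti {D' : V → V → Prop} {S : Finset V} (h : AcyclicOn D S)
    (hD : ∀ x ∈ S, ∀ y ∈ S, D' x y → D x y) : AcyclicOn D' S := by
  intro T hT hne
  obtain ⟨v, hv, hw⟩ := h T hT hne
  exact ⟨v, hv, fun w hwT hd => hw w hwT (hD w (hT hwT) v (hT hv) hd)⟩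

/-- In-neighbours of `y` which are isolated in `S` and not joined back from `y` do not help to
close a cycle through `y`. -/
theorem AcyclicOn.insert_of_in {S : Finset V} {y : V} (h : AcyclicOn D S) (hy : ¬ D y y)
    (hin : ∀ z ∈ S, D z y → ¬ D y z ∧ ∀ w ∈ S, ¬ D w z ∧ ¬ D z w) :
    AcyclicOn D (insert y S) := by
  intro T hT hne
  by_cases hyT : y ∈ T
  · by_cases hz : ∃ z ∈ T, D z y
    · obtain ⟨z, hzT, hzy⟩ := hz
      have hzS : z ∈ S := by
        rcases mem_insert.1 (hT hzT) with rfl | h'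
        · exact absurd hzy hy
        · exact h'
      refine ⟨z, hzT, fun w hw hwz => ?_⟩
      rcases mem_insert.1 (hT hw) with rfl | h'
      · exact (hin z hzS hzy).1 hwz
      · exact ((hin z hzS hzy).2 w h').1 hwz
    · push Not at hz
      exact ⟨y, hyT, hz⟩
  · refine h T (fun x hx => ?_) hne
    rcases mem_insert.1 (hT hx) with rfl | h'
    · exact absurd hx hyT
    · exact h'

/-- The mirror image of `AcyclicOn.insert_of_in`. -/
theorem AcyclicOn.insert_of_out {S : Finset V} {y : V} (h : AcyclicOn D S) (hy : ¬ D y y)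
    (hout : ∀ z ∈ S, D y z → ¬ D z y ∧ ∀ w ∈ S, ¬ D w z ∧ ¬ D z w) :
    AcyclicOn D (insert y S) := by
  intro T hT hne
  by_cases hyT : y ∈ T
  · by_cases hne' : ({z ∈ T | z ∈ S ∧ ¬ D y z} : Finset V).Nonempty
    · obtain ⟨v, hv, hw⟩ := h _ (fun x hx => (mem_filter.1 hx).2.1) hne'
      obtain ⟨hvT, hvS, hyv⟩ := mem_filter.1 hv
      refine ⟨v, hvT, fun w hwT hwv => ?_⟩
      rcases mem_insert.1 (hT hwT) with rfl | hwS
      · exact hyv hwv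
      · by_cases hyw : D y w
        · exact ((hout w hwS hyw).2 v hvS).2 hwv
        · exact hw w (mem_filter.2 ⟨hwT, hwS, hyw⟩) hwv
    · refine ⟨y, hyT, fun w hwT hwy => ?_⟩
      rcases mem_insert.1 (hT hwT) with rfl | hwS
      · exact hy hwy
      · by_cases hyw : D y w
        · exact (hout w hwS hyw).1 hwy
        · exact hne' ⟨w, mem_filter.2 ⟨hwT, hwS, hyw⟩⟩
  · refine h T (fun x hx => ?_) hne
    rcases mem_insert.1 (hT hx) with rfl | h'
    · exact absurd hx hyT
    · exact h'

theorem AcyclicOn.insert_of_no_in {S : Finset V} {y : V} (h : AcyclicOn D S) (hy : ¬ D y y)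
    (hin : ∀ z ∈ S, ¬ D z y) : AcyclicOn D (insert y S) :=
  h.insert_of_in hy fun z hz hzy => absurd hzy (hin z hz)

theorem AcyclicOn.insert_of_no_out {S : Finset V} {y : V} (h : AcyclicOn D S) (hy : ¬ D y y)
    (hout : ∀ z ∈ S, ¬ D y z) : AcyclicOn D (insert y S) :=
  h.insert_of_out hy fun z hz hyz => absurd hyz (hout z hz)

theorem exists_in_of_not_acyclicOn_insert {S : Finset V} {y : V} (h : AcyclicOn D S)
    (hy : ¬ D y y) (hn : ¬ AcyclicOn D (insert y S)) : ∃ z ∈ S, D z y := by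
  by_contra! hc
  exact hn (h.insert_of_no_in hy hc)

theorem exists_out_of_not_acyclicOn_insert {S : Finset V} {y : V} (h : AcyclicOn D S)
    (hy : ¬ D y y) (hn : ¬ AcyclicOn D (insert y S)) : ∃ z ∈ S, D y z := by
  by_contra! hc
  exact hn (h.insert_of_no_out hy hc)

theorem two_le_degreeTo_of_not_acyclicOn_insert {S : Finset V} {y : V} (h : AcyclicOn D S)
    (hy : ¬ D y y) (hn : ¬ AcyclicOn D (insert y S)) : 2 ≤ degreeTo D y S := by
  obtain ⟨z, hz, hzy⟩ := exists_in_of_not_acyclicOn_insert h hy hn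
  obtain ⟨z', hz', hzy'⟩ := exists_out_of_not_acyclicOn_insert h hy hn
  have h1 : 0 < #{w ∈ S | D w y} := card_pos.2 ⟨z, mem_filter.2 ⟨hz, hzy⟩⟩
  have h2 : 0 < #{w ∈ S | D y w} := card_pos.2 ⟨z', mem_filter.2 ⟨hz', hzy'⟩⟩
  unfold degreeTo
  omega

theorem degreeTo_mono (v : V) {S T : Finset V} (h : S ⊆ T) : degreeTo D v S ≤ degreeTo D v T :=
  Nat.add_le_add (card_le_card (filter_subset_filter _ h))
    (card_le_card (filter_subset_filter _ h))

theorem degreeTo_union (v : V) {S T : Finset V} (h : Disjoint S T) :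
    degreeTo D v (S ∪ T) = degreeTo D v S + degreeTo D v T := by
  unfold degreeTo
  rw [filter_union, filter_union, card_union_of_disjoint (disjoint_filter_filter h),
    card_union_of_disjoint (disjoint_filter_filter h)]
  omega

theorem degreeTo_eq_sum (v : V) (S : Finset V) :
    degreeTo D v S = ∑ w ∈ S, ((if D w v then 1 else 0) + (if D v w then 1 else 0)) := by
  rw [degreeTo, card_filter, card_filter, sum_add_distrib]

theorem degreeTo_le_of_imp {D' : V → V → Prop} (h : ∀ x y, D' x y → D x y) (v : V)
    (S : Finset V) : degreeTo D' v S ≤ degreeTo D v S :=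
  Nat.add_le_add (card_le_card (monotone_filter_right _ fun _ _ => h _ _))
    (card_le_card (monotone_filter_right _ fun _ _ => h _ _))

theorem degreeTo_subtype_univ (B : Finset V) (v : B) :
    degreeTo (fun x y : B => D x y) v univ = degreeTo D v B := by
  rw [degreeTo_eq_sum, degreeTo_eq_sum]
  exact sum_coe_sort B fun w => (if D w v then 1 else 0) + (if D v w then 1 else 0)

/-- The digraph `D` with all edges that do not lie inside `U` removed. -/
def restrictTo (D : V → V → Prop) (U : Finset V) : V → V → Prop :=
  fun x y => D x y ∧ x ∈ U ∧ y ∈ U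

theorem degreeTo_filter_eq_sum (v : V) (B : Finset V) (c : V → κ) (C : Finset κ)
    (h : ∀ w ∈ B, c w ∈ C) :
    degreeTo D v B = ∑ j ∈ C, degreeTo D v {w ∈ B | c w = j} := by
  simp only [degreeTo_eq_sum]
  exact (sum_fiberwise_of_maps_to h _).symm

/-- If `W + y` contains a cycle but `W - z + y` does not, then all cycles of `W + y` pass
through `z`. -/
theorem two_le_degreeTo_of_exchange {W : Finset V} {y z : V} (hz : ¬ D z z) (hzW : z ∈ W)
    (hn : ¬ AcyclicOn D (insert y W)) (h : AcyclicOn D (insert y (W.erase z))) :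
    2 ≤ degreeTo D z (insert y (W.erase z)) := by
  refine two_le_degreeTo_of_not_acyclicOn_insert h hz ?_
  rwa [Finset.insert_comm, insert_erase hzW]

/-- An acyclic set can be listed in such a way that no edge of `D` goes backwards. -/
theorem AcyclicOn.exists_list {S : Finset V} (h : AcyclicOn D S) :
    ∃ l : List V, l.Nodup ∧ (∀ x, x ∈ l ↔ x ∈ S) ∧ l.Pairwise fun x y => ¬ D y x := by
  induction hn : #S generalizing S with
  | zero =>
    rw [card_eq_zero] at hn
    subst hn
    exact ⟨[], by simp⟩
  | succ n ih =>
    obtain ⟨v, hv, hw⟩ := h S subset_rfl (card_pos.1 (by omega))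
    obtain ⟨l, hl, hmem, hp⟩ := ih (h.mono (erase_subset v S)) (by rw [card_erase_of_mem hv]; omega)
    refine ⟨v :: l, ?_, ?_, ?_⟩
    · rw [List.nodup_cons]
      exact ⟨fun hvl => by simp [hmem] at hvl, hl⟩
    · intro x
      rw [List.mem_cons, hmem, mem_erase]
      by_cases hx : x = v <;> simp [hx, hv]
    · rw [List.pairwise_cons]
      exact ⟨fun x hx => hw x (mem_of_mem_erase ((hmem x).1 hx)), hp⟩

end Acyclic

/-! ### Reachability and cut vertices in finite digraphs -/

section Reachability

variable {κ : Type v} {r : κ → κ → Prop} {p : κ}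

/-- `ReachesAvoiding r p U x`: there is an `r`-path from `x` to `p` which does not visit `U`. -/
def ReachesAvoiding (r : κ → κ → Prop) (p U x : κ) : Prop :=
  x ≠ U ∧ Relation.ReflTransGen (fun x y => r x y ∧ x ≠ U ∧ y ≠ U) x p

theorem ReachesAvoiding.ne_target {U x : κ} (h : ReachesAvoiding r p U x) : p ≠ U := by
  obtain ⟨hx, h⟩ := h
  rcases Relation.ReflTransGen.cases_tail h with rfl | ⟨y, -, hy⟩
  · exact hx
  · exact hy.2.2

theorem ReachesAvoiding.reaches {U x : κ} (h : ReachesAvoiding r p U x) :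
    Relation.ReflTransGen r x p :=
  h.2.lift id fun _ _ h => h.1

theorem ReachesAvoiding.head {U x y : κ} (h : ReachesAvoiding r p U y) (hx : x ≠ U)
    (hxy : r x y) : ReachesAvoiding r p U x :=
  ⟨hx, Relation.ReflTransGen.head ⟨hxy, hx, h.1⟩ h.2⟩

theorem reachesAvoiding_target {U : κ} (h : p ≠ U) : ReachesAvoiding r p U p :=
  ⟨h, Relation.ReflTransGen.refl⟩

/-- Cutting a path at its last visit to `U`. -/
theorem exists_reachesAvoiding_of_reaches {U : κ} (h : Relation.ReflTransGen r U p) (hU : U ≠ p) :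
    ∃ x, r U x ∧ ReachesAvoiding r p U x := by
  have key : ∀ x, Relation.ReflTransGen r x p →
      ReachesAvoiding r p U x ∨ ∃ y, r U y ∧ ReachesAvoiding r p U y := by
    intro x hx
    induction hx using Relation.ReflTransGen.head_induction_on with
    | refl => exact Or.inl (reachesAvoiding_target hU.symm)
    | @head x y hxy _ ih =>
      rcases ih with ih | ih
      · by_cases hxU : x = U
        · subst hxU
          exact Or.inr ⟨y, hxy, ih⟩
        · exact Or.inl (ih.head hxU hxy)
      · exact Or.inr ih
  rcases key U h with h' | h'
  · exact absurd rfl h'.1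
  · exact h'

/-- A path to `p` can be cut at its first visit to `p`, and then again at the first visit to the
vertex `j` preceding `p`. -/
theorem exists_path_to_last {i : κ} (h : Relation.ReflTransGen r i p) (hi : i ≠ p) :
    ∃ j, r j p ∧ Relation.ReflTransGen (fun x y => r x y ∧ x ≠ p ∧ y ≠ p ∧ x ≠ j) i j := by
  have h1 : ∃ j, r j p ∧ Relation.ReflTransGen (fun x y => r x y ∧ x ≠ p ∧ y ≠ p) i j := by
    induction h using Relation.ReflTransGen.head_induction_on with
    | refl => exact absurd rfl hi
    | @head x y hxy _ ih =>
      by_cases hy : y = p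
      · subst hy
        exact ⟨x, hxy, .refl⟩
      · obtain ⟨j, hj, hyj⟩ := ih hy
        exact ⟨j, hj, .head ⟨hxy, hi, hy⟩ hyj⟩
  obtain ⟨j, hj, hij⟩ := h1
  refine ⟨j, hj, ?_⟩
  clear hi h
  induction hij using Relation.ReflTransGen.head_induction_on with
  | refl => exact .refl
  | @head x y hxy _ ih =>
    by_cases hx : x = j
    · subst hx
      exact .refl
    · exact .head ⟨hxy.1, hxy.2.1, hxy.2.2, hx⟩ ih

/-- Every vertex of a path avoiding `U` reaches the target without visiting `U`. -/
theorem ReachesAvoiding.of_not {U W x : κ} (h : ReachesAvoiding r p U x)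
    (hW : ¬ ReachesAvoiding r p U W) : ReachesAvoiding r p W x := by
  have hpU := h.ne_target
  obtain ⟨-, h⟩ := h
  have key : ReachesAvoiding r p U x ∧ ReachesAvoiding r p W x := by
    induction h using Relation.ReflTransGen.head_induction_on with
    | refl =>
      refine ⟨reachesAvoiding_target hpU, reachesAvoiding_target ?_⟩
      rintro rfl
      exact hW (reachesAvoiding_target hpU)
    | @head x y hxy _ ih =>
      have hxU := ih.1.head hxy.2.1 hxy.1
      refine ⟨hxU, ih.2.head ?_ hxy.1⟩
      rintro rfl
      exact hW hxU
  exact key.2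

variable [Fintype κ]

/-- The vertices from which `p` can be reached. -/
noncomputable def reachSet (r : κ → κ → Prop) (p : κ) : Finset κ :=
  {x | Relation.ReflTransGen r x p}

/-- The vertices other than `U` all of whose paths to `p` visit `U`. -/
noncomputable def cutSet (r : κ → κ → Prop) (p U : κ) : Finset κ :=
  {x ∈ reachSet r p | x ≠ U ∧ ¬ ReachesAvoiding r p U x}

theorem mem_reachSet {x : κ} : x ∈ reachSet r p ↔ Relation.ReflTransGen r x p := by
  simp [reachSet]

theorem mem_cutSet {U x : κ} :
    x ∈ cutSet r p U ↔ x ∈ reachSet r p ∧ x ≠ U ∧ ¬ ReachesAvoiding r p U x := by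
  simp [cutSet]

theorem target_notMem_cutSet (U : κ) : p ∉ cutSet r p U := by
  rw [mem_cutSet]
  rintro ⟨-, h, h'⟩
  exact h' (reachesAvoiding_target h)

/-- A vertex separated from `p` by `U` separates fewer vertices from `p` than `U` does. -/
theorem cutSet_ssubset {U W : κ} (hU : U ∈ reachSet r p) (hW : W ∈ cutSet r p U) :
    cutSet r p W ⊂ cutSet r p U := by
  obtain ⟨hWr, hWU, hWn⟩ := mem_cutSet.1 hW
  refine (ssubset_iff_of_subset fun x hx => ?_).2 ⟨W, hW, fun h => (mem_cutSet.1 h).2.1 rfl⟩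
  obtain ⟨hxr, hxW, hxn⟩ := mem_cutSet.1 hx
  have hpW : p ≠ W := by
    rintro rfl
    exact target_notMem_cutSet _ hW
  refine mem_cutSet.2 ⟨hxr, ?_, fun h => hxn (h.of_not hWn)⟩
  rintro rfl
  by_cases hxp : x = p
  · subst hxp
    exact hxn (reachesAvoiding_target hxW)
  · obtain ⟨y, hxy, hy⟩ := exists_reachesAvoiding_of_reaches (mem_reachSet.1 hU) hxp
    exact hxn ((hy.of_not hWn).head hxW hxy)

/-- If `p` is not the only vertex reaching `p`, some vertex `U` separates from `p` a nonempty set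
of vertices none of which is itself a cut vertex. A minimal nonempty `cutSet` has this property. -/
theorem exists_cutSet_terminal (h : 2 ≤ #(reachSet r p)) :
    ∃ U ∈ reachSet r p, (cutSet r p U).Nonempty ∧
      ∀ W ∈ cutSet r p U, ∀ x ∈ reachSet r p, x ≠ W → ReachesAvoiding r p W x := by
  have hp : p ∈ reachSet r p := mem_reachSet.2 .refl
  have hne : ({U ∈ reachSet r p | (cutSet r p U).Nonempty} : Finset κ).Nonempty := by
    obtain ⟨x, hx, hxp⟩ := exists_mem_ne (s := reachSet r p) (by omega) p
    refine ⟨p, mem_filter.2 ⟨hp, x, mem_cutSet.2 ⟨hx, hxp, fun h' => h'.ne_target rfl⟩⟩⟩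
  obtain ⟨U, hU, hmin⟩ := exists_min_image _ (fun U => #(cutSet r p U)) hne
  obtain ⟨hUr, hUne⟩ := mem_filter.1 hU
  refine ⟨U, hUr, hUne, fun W hW x hx hxW => ?_⟩
  by_contra hn
  have := hmin W (mem_filter.2 ⟨(mem_cutSet.1 hW).1, x, mem_cutSet.2 ⟨hx, hxW, hn⟩⟩)
  exact absurd (card_lt_card (cutSet_ssubset hUr hW)) (by omega)

theorem mem_cutSet_of_rel {U W x : κ} (hW : W ∈ cutSet r p U) (hWx : r W x)
    (hx : x ∈ reachSet r p) (hxU : x ≠ U) : x ∈ cutSet r p U := by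
  obtain ⟨-, hWU, hWn⟩ := mem_cutSet.1 hW
  exact mem_cutSet.2 ⟨hx, hxU, fun h => hWn (h.head hWU hWx)⟩

end Reachability

/-! ### Recolouring along paths of moves -/

section Colouring

variable {V : Type u} {κ : Type v} [Fintype V] {D : V → V → Prop}

/-- The set of vertices of colour `i`. -/
noncomputable def colourClass (c : V → κ) (i : κ) : Finset V := {v | c v = i}

@[simp] theorem mem_colourClass {c : V → κ} {i : κ} {v : V} : v ∈ colourClass c i ↔ c v = i := by
  simp [colourClass]

/-- Some vertex of colour `i` can be recoloured with `j` without creating a directed cycle inside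
the class of `j`. -/
def CanMove (D : V → V → Prop) (c : V → κ) (i j : κ) : Prop :=
  i ≠ j ∧ ∃ v, c v = i ∧ AcyclicOn D (insert v (colourClass c j))

theorem colourClass_update_self (c : V → κ) (v : V) (j : κ) :
    colourClass (Function.update c v j) j = insert v (colourClass c j) := by
  ext x
  by_cases hx : x = v <;> simp [hx]

theorem colourClass_update_of_ne (c : V → κ) (v : V) {i j : κ} (h : i ≠ j) :
    colourClass (Function.update c v j) i = (colourClass c i).erase v := by
  ext x
  by_cases hx : x = v <;> simp [hx, h.symm]

/-- Sizes of the colour classes after recolouring one vertex. -/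
theorem card_colourClass_update (c : V → κ) (v : V) (j i : κ) :
    #(colourClass (Function.update c v j) i) + (if i = c v then 1 else 0) =
      #(colourClass c i) + (if i = j then 1 else 0) := by
  by_cases hj : i = j
  · subst hj
    rw [colourClass_update_self]
    by_cases hv : i = c v
    · rw [insert_eq_of_mem (by simp [hv])]
      simp [hv]
    · rw [card_insert_of_notMem (by simp [Ne.symm hv])]
      simp [hv]
  · rw [colourClass_update_of_ne c v hj]
    by_cases hv : i = c v
    · have hm : v ∈ colourClass c i := by simp [hv]
      have := card_pos.2 ⟨v, hm⟩
      rw [card_erase_of_mem hm]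
      rw [if_pos hv, if_neg hj]
      omega
    · rw [erase_eq_of_notMem (by simp [Ne.symm hv])]
      simp [hv, hj]

/-- Recolouring along a path of possible moves: the first class of the path loses a vertex, the
last class gains one, and the sizes of all other classes are unchanged. Only vertices with colours
in `F` are recoloured, where `F` contains the path. -/
theorem exists_shift (F : Finset κ) (c : V → κ) (i p : κ)
    (hac : ∀ j, AcyclicOn D (colourClass c j))
    (hpath : Relation.ReflTransGen (fun x y => CanMove D c x y ∧ x ∈ F ∧ y ∈ F) i p) :
    ∃ c' : V → κ, (∀ j, AcyclicOn D (colourClass c' j)) ∧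
      (∀ j, #(colourClass c' j) + (if j = i then 1 else 0) =
        #(colourClass c j) + (if j = p then 1 else 0)) ∧
      colourClass c' i ⊆ colourClass c i ∧
      ∀ j ∉ F, colourClass c' j = colourClass c j := by
  induction hn : #F generalizing F c p with
  | zero =>
    rw [card_eq_zero] at hn
    subst hn
    rcases Relation.ReflTransGen.cases_tail hpath with rfl | ⟨_, _, h⟩
    · exact ⟨c, hac, fun j => rfl, subset_rfl, fun _ _ => rfl⟩
    · exact absurd h.2.1 (notMem_empty _)
  | succ n ih =>
    by_cases hip : i = p
    · subst hip
      exact ⟨c, hac, fun j => rfl, subset_rfl, fun _ _ => rfl⟩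
    obtain ⟨j, ⟨⟨hjp, v, hv, hvac⟩, hjF, hpF⟩, hpath⟩ := exists_path_to_last hpath hip
    have hcls : ∀ m, m ≠ p → colourClass (Function.update c v p) m ⊆ colourClass c m := by
      intro m hm
      rw [colourClass_update_of_ne c v hm]
      exact erase_subset _ _
    obtain ⟨c', hac', hcard, hsub, hout⟩ := ih (F.erase p) (Function.update c v p) j
      (fun m => by
        by_cases hm : m = p
        · subst hm
          rwa [colourClass_update_self]
        · exact (hac m).mono (hcls m hm))
      (hpath.lift id (by
        rintro x y ⟨⟨⟨hxy, w, hw, hwac⟩, hxF, hyF⟩, hxp, hyp, hxj⟩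
        refine ⟨⟨hxy, w, ?_, hwac.mono (insert_subset_insert _ (hcls y hyp))⟩,
          mem_erase.2 ⟨hxp, hxF⟩, mem_erase.2 ⟨hyp, hyF⟩⟩
        have hwv : w ≠ v := by
          rintro rfl
          exact hxj (hw.symm.trans hv)
        rw [Function.update_of_ne hwv, hw]
        rfl))
      (by rw [card_erase_of_mem hpF]; omega)
    refine ⟨c', hac', fun m => ?_, hsub.trans (hcls i hip), fun m hm => ?_⟩
    · have h1 := hcard m
      have h2 := card_colourClass_update c v p m
      rw [hv] at h2
      omega
    · have hmp : m ≠ p := by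
        rintro rfl
        exact hm hpF
      have hmj : m ≠ j := by
        rintro rfl
        exact hm hjF
      rw [hout m (fun h => hm (mem_of_mem_erase h)), colourClass_update_of_ne c v hmp,
        erase_eq_of_notMem (by simp [hv, hmj.symm])]

end Colouring

/-! ### Double counting of relevant edges at a class -/

section Counting

variable {V : Type u} {D : V → V → Prop} {W B : Finset V}

/-- The vertex `z` has no neighbour in `W`. -/
def IsolatedIn (D : V → V → Prop) (W : Finset V) (z : V) : Prop := ∀ w ∈ W, ¬ D w z ∧ ¬ D z w

/-- The vertices of `W` which can be exchanged for a vertex of `B` without creating a cycle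
in `W`. -/
noncomputable def soloSet (D : V → V → Prop) (W B : Finset V) : Finset V :=
  {z ∈ W | ∃ y ∈ B, AcyclicOn D (insert y (W.erase z))}

/-- The edge from `z` to `y` can lie on a cycle of `W + y`: either it lies on a 2-cycle or `z` has
a neighbour in `W`. -/
def RelevantIn (D : V → V → Prop) (W : Finset V) (y z : V) : Prop :=
  D z y ∧ (D y z ∨ ¬ IsolatedIn D W z)

/-- The edge from `y` to `z` can lie on a cycle of `W + y`. -/
def RelevantOut (D : V → V → Prop) (W : Finset V) (y z : V) : Prop :=
  D y z ∧ (D z y ∨ ¬ IsolatedIn D W z)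

/-- Discarding the irrelevant edges saves one in the degree of `z` to `B`, since the relevant
edges at an isolated vertex come in pairs. -/
theorem sum_relevant_le {z : V} {m : ℕ} (h : degreeTo D z W + degreeTo D z B ≤ 2 * m + 1) :
    ∑ y ∈ B, ((if RelevantIn D W y z then 1 else 0) + (if RelevantOut D W y z then 1 else 0))
      ≤ 2 * m := by
  by_cases hz : IsolatedIn D W z
  · have e : ∀ y ∈ B, ((if RelevantIn D W y z then 1 else 0) +
        (if RelevantOut D W y z then 1 else 0)) = 2 * (if D z y ∧ D y z then 1 else 0) := by
      intro y _
      by_cases h1 : D z y <;> by_cases h2 : D y z <;> simp [RelevantIn, RelevantOut, h1, h2, hz]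
    rw [sum_congr rfl e, ← mul_sum, ← card_filter]
    have h1 : #{y ∈ B | D z y ∧ D y z} ≤ #{y ∈ B | D y z} :=
      card_le_card (monotone_filter_right _ fun _ _ h => h.2)
    have h2 : #{y ∈ B | D z y ∧ D y z} ≤ #{y ∈ B | D z y} :=
      card_le_card (monotone_filter_right _ fun _ _ h => h.1)
    unfold degreeTo at h
    omega
  · have e : ∑ y ∈ B, ((if RelevantIn D W y z then 1 else 0) +
        (if RelevantOut D W y z then 1 else 0)) = degreeTo D z B := by
      rw [degreeTo_eq_sum]
      refine sum_congr rfl fun y _ => ?_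
      simp [RelevantIn, RelevantOut, hz, add_comm]
    have hpos : 1 ≤ degreeTo D z W := by
      unfold IsolatedIn at hz
      push Not at hz
      obtain ⟨w, hw, hwz⟩ := hz
      unfold degreeTo
      by_cases h1 : D w z
      · have : 0 < #{x ∈ W | D x z} := card_pos.2 ⟨w, mem_filter.2 ⟨hw, h1⟩⟩
        omega
      · have : 0 < #{x ∈ W | D z x} := card_pos.2 ⟨w, mem_filter.2 ⟨hw, hwz h1⟩⟩
        omega
    omega

theorem two_le_sum_of_singleton {N : Finset V} {f : V → ℕ} (hN : N.Nonempty)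
    (hf : ∀ z ∈ N, 1 ≤ f z) (h1 : ∀ z, N = {z} → 2 ≤ f z) : 2 ≤ ∑ z ∈ N, f z := by
  by_cases hc : #N = 1
  · obtain ⟨z, rfl⟩ := card_eq_one.1 hc
    simpa using h1 z rfl
  · have := card_pos.2 hN
    have h2 : ∑ z ∈ N, 1 ≤ ∑ z ∈ N, f z := sum_le_sum hf
    simp only [sum_const, smul_eq_mul, mul_one] at h2
    omega

theorem RelevantIn.mono {W' : Finset V} (hW : W' ⊆ W) {y z : V} (h : RelevantIn D W' y z) :
    RelevantIn D W y z :=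
  ⟨h.1, h.2.imp_right fun h' h'' => h' fun w hw => h'' w (hW hw)⟩

theorem RelevantOut.mono {W' : Finset V} (hW : W' ⊆ W) {y z : V} (h : RelevantOut D W' y z) :
    RelevantOut D W y z :=
  ⟨h.1, h.2.imp_right fun h' h'' => h' fun w hw => h'' w (hW hw)⟩

theorem acyclicOn_insert_of_not_relevantIn {y : V} (hW : AcyclicOn D W) (hy : ¬ D y y)
    (h : ∀ z ∈ W, ¬ RelevantIn D W y z) : AcyclicOn D (insert y W) := by
  refine hW.insert_of_in hy fun z hz hzy => ?_
  have := h z hz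
  rw [RelevantIn, not_and, not_or, not_not] at this
  exact this hzy

theorem acyclicOn_insert_of_not_relevantOut {y : V} (hW : AcyclicOn D W) (hy : ¬ D y y)
    (h : ∀ z ∈ W, ¬ RelevantOut D W y z) : AcyclicOn D (insert y W) := by
  refine hW.insert_of_out hy fun z hz hzy => ?_
  have := h z hz
  rw [RelevantOut, not_and, not_or, not_not] at this
  exact this hzy

/-- Double counting of the relevant edges between `W` and `B`, where edges at solo vertices count
twice: every vertex of `B` then sees at least four of them, since a unique relevant in-neighbour
or out-neighbour is solo. -/
theorem four_mul_card_le (hD : ∀ x, ¬ D x x) (hW : AcyclicOn D W)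
    (hB : ∀ y ∈ B, ¬ AcyclicOn D (insert y W)) {m n : ℕ}
    (hm : ∀ z ∈ soloSet D W B, degreeTo D z W + degreeTo D z B ≤ 2 * m + 1)
    (hn : ∀ z ∈ W, degreeTo D z W + degreeTo D z B ≤ 2 * n + 1) :
    4 * #B ≤ 4 * m * #(soloSet D W B) + 2 * n * #(W \ soloSet D W B) := by
  set S := soloSet D W B with hS
  have hSW : S ⊆ W := filter_subset _ _
  let mult : V → ℕ := fun z => if z ∈ S then 2 else 1
  let wt : V → V → ℕ := fun y z =>
    (if RelevantIn D W y z then 1 else 0) + (if RelevantOut D W y z then 1 else 0)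
  have hmult : ∀ z, 1 ≤ mult z := by
    intro z
    by_cases hz : z ∈ S <;> simp [mult, hz]
  have hrow : ∀ y ∈ B, 4 ≤ ∑ z ∈ W, mult z * wt y z := by
    intro y hy
    have e : ∑ z ∈ W, mult z * wt y z =
        ∑ z ∈ W with RelevantIn D W y z, mult z + ∑ z ∈ W with RelevantOut D W y z, mult z := by
      rw [sum_filter, sum_filter, ← sum_add_distrib]
      refine sum_congr rfl fun z _ => ?_
      simp only [wt, mul_add, mul_ite, mul_one, mul_zero]
    have h1 : 2 ≤ ∑ z ∈ W with RelevantIn D W y z, mult z := by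
      refine two_le_sum_of_singleton ?_ (fun z _ => hmult z) fun z hz => ?_
      · by_contra hne
        refine hB y hy (acyclicOn_insert_of_not_relevantIn hW (hD y) fun z hz hr => ?_)
        exact hne ⟨z, mem_filter.2 ⟨hz, hr⟩⟩
      · have hzS : z ∈ S := by
          have hz' : z ∈ ({z ∈ W | RelevantIn D W y z} : Finset V) := by simp [hz]
          refine mem_filter.2 ⟨(mem_filter.1 hz').1, y, hy, ?_⟩
          refine acyclicOn_insert_of_not_relevantIn (hW.mono (erase_subset _ _)) (hD y) ?_
          intro x hx hr
          have hx' : x ∈ ({z ∈ W | RelevantIn D W y z} : Finset V) :=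
            mem_filter.2 ⟨mem_of_mem_erase hx, hr.mono (erase_subset _ _)⟩
          rw [hz, mem_singleton] at hx'
          exact ne_of_mem_erase hx hx'
        simp [mult, hzS]
    have h2 : 2 ≤ ∑ z ∈ W with RelevantOut D W y z, mult z := by
      refine two_le_sum_of_singleton ?_ (fun z _ => hmult z) fun z hz => ?_
      · by_contra hne
        refine hB y hy (acyclicOn_insert_of_not_relevantOut hW (hD y) fun z hz hr => ?_)
        exact hne ⟨z, mem_filter.2 ⟨hz, hr⟩⟩
      · have hzS : z ∈ S := by
          have hz' : z ∈ ({z ∈ W | RelevantOut D W y z} : Finset V) := by simp [hz]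
          refine mem_filter.2 ⟨(mem_filter.1 hz').1, y, hy, ?_⟩
          refine acyclicOn_insert_of_not_relevantOut (hW.mono (erase_subset _ _)) (hD y) ?_
          intro x hx hr
          have hx' : x ∈ ({z ∈ W | RelevantOut D W y z} : Finset V) :=
            mem_filter.2 ⟨mem_of_mem_erase hx, hr.mono (erase_subset _ _)⟩
          rw [hz, mem_singleton] at hx'
          exact ne_of_mem_erase hx hx'
        simp [mult, hzS]
    omega
  have hcolS : ∀ z ∈ S, ∑ y ∈ B, mult z * wt y z ≤ 4 * m := by
    intro z hz
    rw [← mul_sum]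
    have := sum_relevant_le (hm z hz)
    simp only [mult, hz, if_true, wt]
    omega
  have hcolW : ∀ z ∈ W \ S, ∑ y ∈ B, mult z * wt y z ≤ 2 * n := by
    intro z hz
    rw [mem_sdiff] at hz
    rw [← mul_sum]
    have := sum_relevant_le (hn z hz.1)
    simp only [mult, hz.2, if_false, wt]
    omega
  calc 4 * #B = ∑ y ∈ B, 4 := by rw [sum_const, smul_eq_mul, mul_comm]
    _ ≤ ∑ y ∈ B, ∑ z ∈ W, mult z * wt y z := sum_le_sum hrow
    _ = ∑ z ∈ W, ∑ y ∈ B, mult z * wt y z := sum_comm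
    _ = ∑ z ∈ W \ S, ∑ y ∈ B, mult z * wt y z + ∑ z ∈ S, ∑ y ∈ B, mult z * wt y z :=
      (sum_sdiff hSW).symm
    _ ≤ ∑ z ∈ W \ S, 2 * n + ∑ z ∈ S, 4 * m := add_le_add (sum_le_sum hcolW) (sum_le_sum hcolS)
    _ = 4 * m * #S + 2 * n * #(W \ S) := by
      rw [sum_const, sum_const, smul_eq_mul, smul_eq_mul]
      ring

end Counting

/-! ### Nearly equitable colourings and exchanges -/

section Exchange

theorem ReachesAvoiding.path_mem {κ : Type v} [Fintype κ] {r : κ → κ → Prop} {p U x : κ}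
    (h : ReachesAvoiding r p U x) :
    Relation.ReflTransGen (fun x y => r x y ∧ x ∈ (reachSet r p).erase U ∧
      y ∈ (reachSet r p).erase U) x p := by
  have h2 := h.2
  induction h2 using Relation.ReflTransGen.head_induction_on with
  | refl => exact .refl
  | @head x y hxy hy ih =>
    have hy' : ReachesAvoiding r p U y := ⟨hxy.2.2, hy⟩
    exact .head ⟨hxy.1, mem_erase.2 ⟨h.1, mem_reachSet.2 h.reaches⟩,
      mem_erase.2 ⟨hy'.1, mem_reachSet.2 hy'.reaches⟩⟩ (ih hy')

variable {V : Type u} {κ : Type v} [Fintype V] {D : V → V → Prop} {s : ℕ}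

/-- All colour classes are acyclic and have `s` vertices. -/
def IsEquitable (D : V → V → Prop) (s : ℕ) (c : V → κ) : Prop :=
  ∀ j, AcyclicOn D (colourClass c j) ∧ #(colourClass c j) = s

/-- The colouring `g`, restricted to `B`, uses the colours of `C` only, and each of them on an
acyclic set of `s` vertices. -/
def IsEquitableOn (D : V → V → Prop) (s : ℕ) (B : Finset V) (C : Finset κ) (g : V → κ) : Prop :=
  (∀ v ∈ B, g v ∈ C) ∧ ∀ j ∈ C, AcyclicOn D {v ∈ B | g v = j} ∧ #{v ∈ B | g v = j} = s

/-- All colour classes are acyclic; the class of `p` has `s - 1` vertices, the class of `q` has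
`s + 1` vertices, and all others have `s` vertices. -/
structure IsNearlyEquitable (D : V → V → Prop) (s : ℕ) (p q : κ) (c : V → κ) : Prop where
  acyclic : ∀ j, AcyclicOn D (colourClass c j)
  ne : p ≠ q
  card_small : #(colourClass c p) + 1 = s
  card_large : #(colourClass c q) = s + 1
  card_other : ∀ j, j ≠ p → j ≠ q → #(colourClass c j) = s

theorem two_mul_card_le_sum_degreeTo (hD : ∀ x, ¬ D x x)
    (hac : ∀ j, AcyclicOn D (colourClass c j)) {v : V} {N : Finset κ}
    (hN : ∀ X ∈ N, ¬ AcyclicOn D (insert v (colourClass c X))) :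
    2 * #N ≤ ∑ X ∈ N, degreeTo D v (colourClass c X) := by
  rw [mul_comm, ← smul_eq_mul, ← sum_const]
  exact sum_le_sum fun X hX =>
    two_le_degreeTo_of_not_acyclicOn_insert (hac X) (hD v) (hN X hX)

/-- An equitable colouring of the subtype `B` with colours in the subtype `C`, extended to all
vertices by an arbitrary value `i₀`. -/
theorem IsEquitableOn.of_subtype {V : Type u} {κ : Type v} {D : V → V → Prop} {s : ℕ} {B : Finset V} {C : Finset κ} {g : B → C} {i₀ : κ}
    (hg : IsEquitable (fun x y : B => D x y) s g) :
    IsEquitableOn D s B C (fun v => if h : v ∈ B then (g ⟨v, h⟩ : κ) else i₀) := by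
  refine ⟨fun v hv => by simp [hv], fun j hj => ?_⟩
  have e : ({v ∈ B | (if h : v ∈ B then (g ⟨v, h⟩ : κ) else i₀) = j} : Finset V) =
      (colourClass g ⟨j, hj⟩).map (Function.Embedding.subtype _) := by
    ext v
    simp only [mem_filter, mem_map, mem_colourClass, Function.Embedding.subtype_apply]
    constructor
    · rintro ⟨hv, h⟩
      rw [dif_pos hv] at h
      exact ⟨⟨v, hv⟩, Subtype.ext h, rfl⟩
    · rintro ⟨⟨w, hw⟩, h, rfl⟩
      exact ⟨hw, by rw [dif_pos hw, h]⟩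
  rw [e, card_map]
  refine ⟨fun T hT hne => ?_, (hg ⟨j, hj⟩).2⟩
  obtain ⟨R, hR, rfl⟩ := subset_map_iff.1 hT
  obtain ⟨v, hv, hw⟩ := (hg ⟨j, hj⟩).1 R hR (map_nonempty.1 hne)
  refine ⟨v, mem_map_of_mem _ hv, fun w hwR => ?_⟩
  obtain ⟨w', hw', rfl⟩ := mem_map.1 hwR
  exact hw w' hw'

variable [Fintype κ] {p q : κ} {c : V → κ}

/-- The colour classes from which the small class can be reached by moves. -/
noncomputable abbrev reachable (D : V → V → Prop) (c : V → κ) (p : κ) : Finset κ :=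
  reachSet (CanMove D c) p

/-- The vertices whose colour does not reach the small class. -/
noncomputable def unreachableVerts (D : V → V → Prop) (c : V → κ) (p : κ) : Finset V :=
  {v | c v ∉ reachable D c p}

theorem mem_unreachableVerts {v : V} : v ∈ unreachableVerts D c p ↔ c v ∉ reachable D c p := by
  simp [unreachableVerts]

theorem small_mem_reachable : p ∈ reachable D c p := mem_reachSet.2 .refl

theorem not_acyclicOn_insert_of_unreachable {y : V} {j : κ} (hy : y ∈ unreachableVerts D c p)
    (hj : j ∈ reachable D c p) : ¬ AcyclicOn D (insert y (colourClass c j)) := by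
  rw [mem_unreachableVerts] at hy
  intro h
  refine hy (mem_reachSet.2 (.head ⟨?_, y, rfl, h⟩ (mem_reachSet.1 hj)))
  rintro rfl
  exact hy hj

/-- If the large class is reachable, a shift along a path to the small class suffices. -/
theorem IsNearlyEquitable.exists_of_large_mem (hc : IsNearlyEquitable D s p q c)
    (hq : q ∈ reachable D c p) : ∃ c' : V → κ, IsEquitable D s c' := by
  obtain ⟨c', hac, hcard, -, -⟩ := exists_shift univ c q p hc.acyclic
    ((mem_reachSet.1 hq).lift id fun x y h => ⟨h, mem_univ x, mem_univ y⟩)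
  refine ⟨c', fun j => ⟨hac j, ?_⟩⟩
  have h := hcard j
  by_cases hjp : j = p
  · subst hjp
    rw [if_neg hc.ne, if_pos rfl] at h
    have := hc.card_small
    omega
  · by_cases hjq : j = q
    · subst hjq
      rw [if_pos rfl, if_neg hjp, hc.card_large] at h
      omega
    · rw [if_neg hjq, if_neg hjp, hc.card_other j hjp hjq] at h
      omega

/-- If a vertex `z` of the class `W` can be exchanged for a vertex `y` of an unreachable class,
and can itself be moved to a class `X` which reaches the small class without using `W`, then an
equitable colouring exists, provided the remaining unreachable vertices can be recoloured. -/
theorem IsNearlyEquitable.exists_of_move (hc : IsNearlyEquitable D s p q c)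
    (hq : q ∉ reachable D c p) {W X : κ} {y z : V} (hW : W ∈ reachable D c p) (hz : c z = W)
    (hy : y ∈ unreachableVerts D c p) (hyz : AcyclicOn D (insert y ((colourClass c W).erase z)))
    (hX : ReachesAvoiding (CanMove D c) p W X) (hzX : AcyclicOn D (insert z (colourClass c X)))
    {g : V → κ}
    (hg : IsEquitableOn D s ((unreachableVerts D c p).erase y) (reachable D c p)ᶜ g) :
    ∃ c' : V → κ, IsEquitable D s c' := by
  obtain ⟨c', hac, hcard, hsub, hout⟩ := exists_shift _ c X p hc.acyclic hX.path_mem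
  set A := reachable D c p with hA
  have hy' := mem_unreachableVerts.1 hy
  have hXA : X ∈ A := mem_reachSet.2 hX.reaches
  have hpA : p ∈ A := small_mem_reachable
  have hpW := hX.ne_target
  have hmem : ∀ v j, j ∉ A.erase W → (c' v = j ↔ c v = j) := by
    intro v j hj
    rw [← mem_colourClass, hout j hj, mem_colourClass]
  have hWF : W ∉ A.erase W := fun h => (mem_erase.1 h).1 rfl
  have hcA : ∀ v, c' v ∈ A ↔ c v ∈ A := by
    intro v
    constructor
    · intro h
      by_contra hv
      have := (hmem v (c v) fun h' => hv (mem_of_mem_erase h')).2 rfl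
      exact hv (this ▸ h)
    · intro h
      by_contra hv
      have := (hmem v (c' v) fun h' => hv (mem_of_mem_erase h')).1 rfl
      exact hv (this ▸ h)
  have hzy : z ≠ y := by
    rintro rfl
    exact hy' (hz ▸ hW)
  have hc'z : c' z = W := (hmem z W hWF).2 hz
  have hsize : ∀ j ∈ A, #(colourClass c' j) + (if j = X then 1 else 0) = s := by
    intro j hj
    rw [hcard j]
    by_cases hjp : j = p
    · subst hjp
      simpa using hc.card_small
    · rw [if_neg hjp, hc.card_other j hjp (by rintro rfl; exact hq hj)]
      rfl
  -- After the shift the class of `X` is the small one; it receives `z`, whose place `y` takes.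
  let d : V → κ := fun v =>
    if v = z then X else if v = y then W else if c v ∈ A then c' v else g v
  have hdz : d z = X := if_pos rfl
  have hdy : d y = W := (if_neg hzy.symm).trans (if_pos rfl)
  have hdA : ∀ v, v ≠ z → c v ∈ A → d v = c' v := by
    intro v hv hvA
    have hvy : v ≠ y := by
      rintro rfl
      exact hy' hvA
    simp only [d]
    rw [if_neg hv, if_neg hvy, if_pos hvA]
  have hdB : ∀ v, v ≠ y → c v ∉ A → d v = g v := by
    intro v hv hvA
    have hvz : v ≠ z := by
      rintro rfl
      exact hvA (hz ▸ hW)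
    simp only [d]
    rw [if_neg hvz, if_neg hv, if_neg hvA]
  have hgA : ∀ v, v ≠ y → c v ∉ A → g v ∉ A := fun v hv hvA =>
    mem_compl.1 (hg.1 v (mem_erase.2 ⟨hv, mem_unreachableVerts.2 hvA⟩))
  have hcase : ∀ j ∈ A, ∀ v, d v = j ↔
      (v = z ∧ j = X) ∨ (v = y ∧ j = W) ∨ (v ≠ z ∧ c' v = j) := by
    intro j hj v
    by_cases hvz : v = z
    · subst hvz
      rw [hdz]
      have : ¬ (v = y) := hzy
      simp [this, eq_comm]
    · by_cases hvy : v = y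
      · subst hvy
        rw [hdy]
        have : c' v ≠ j := by
          rintro rfl
          exact hy' ((hcA v).1 hj)
        simp [hvz, this, eq_comm]
      · by_cases hvA : c v ∈ A
        · rw [hdA v hvz hvA]
          simp [hvz, hvy]
        · rw [hdB v hvy hvA]
          have h1 : g v ≠ j := by
            rintro rfl
            exact hgA v hvy hvA hj
          have h2 : c' v ≠ j := by
            rintro rfl
            exact hvA ((hcA v).1 hj)
          simp [hvz, hvy, h1, h2]
  refine ⟨d, fun j => ?_⟩
  by_cases hj : j ∈ A
  · by_cases hjX : j = X
    · subst hjX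
      have hjW : j ≠ W := hX.1
      have e : colourClass d j = insert z (colourClass c' j) := by
        ext v
        rw [mem_colourClass, hcase j hj, mem_insert, mem_colourClass]
        by_cases hvz : v = z <;> simp [hvz, hjW]
      have hn : z ∉ colourClass c' j := by
        rw [mem_colourClass, hc'z]
        exact hjW.symm
      rw [e, card_insert_of_notMem hn]
      refine ⟨hzX.mono (insert_subset_insert _ hsub), ?_⟩
      simpa using hsize j hj
    · by_cases hjW : j = W
      · subst hjW
        have e : colourClass d j = insert y ((colourClass c j).erase z) := by
          ext v
          rw [mem_colourClass, hcase j hj, mem_insert, mem_erase, mem_colourClass, hmem v j hWF]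
          simp [hjX]
        rw [e]
        refine ⟨hyz, ?_⟩
        have hzm : z ∈ colourClass c j := mem_colourClass.2 hz
        rw [card_insert_of_notMem, card_erase_add_one hzm]
        · exact hc.card_other j hpW.symm (by rintro rfl; exact hq hj)
        · intro h
          exact hy' (mem_colourClass.1 (mem_of_mem_erase h) ▸ hj)
      · have e : colourClass d j = colourClass c' j := by
          ext v
          rw [mem_colourClass, hcase j hj, mem_colourClass]
          by_cases hvz : v = z
          · subst hvz
            simp [hjX, hjW, hc'z, Ne.symm hjW]
          · simp [hvz, hjW]
        rw [e]
        refine ⟨hac j, ?_⟩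
        simpa [hjX] using hsize j hj
  · have e : colourClass d j = {v ∈ (unreachableVerts D c p).erase y | g v = j} := by
      ext v
      rw [mem_colourClass, mem_filter, mem_erase, mem_unreachableVerts]
      by_cases hvy : v = y
      · subst hvy
        rw [hdy]
        simp only [ne_eq, not_true_eq_false, false_and, iff_false]
        rintro rfl
        exact hj hW
      · by_cases hvA : c v ∈ A
        · have : d v ≠ j := by
            rintro rfl
            by_cases hvz : v = z
            · subst hvz
              exact hj (hdz ▸ hXA)
            · rw [hdA v hvz hvA] at hj
              exact hj ((hcA v).2 hvA)
          have hvA' : c v ∈ reachable D c p := hvA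
          simp [this, hvA']
        · rw [hdB v hvy hvA]
          have hvA' : c v ∉ reachable D c p := hvA
          simp [hvy, hvA']
    rw [e]
    exact hg.2 j (mem_compl.2 hj)

/-- If a vertex `z` of a class `W` is exchanged for a vertex `y` of an unreachable class, and `z`
fits into one of the recoloured unreachable classes, then the colouring remains nearly equitable.
The number of reachable classes grows if another unreachable vertex `y'` can now be moved
to `W`. -/
theorem IsNearlyEquitable.exists_of_exchange (hc : IsNearlyEquitable D s p q c)
    (hq : q ∉ reachable D c p) {W j₀ : κ} {y y' z : V} (hW : W ∈ reachable D c p) (hWp : W ≠ p)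
    (hterm : ∀ X ∈ reachable D c p, X ≠ W → ReachesAvoiding (CanMove D c) p W X)
    (hz : c z = W) (hy : y ∈ unreachableVerts D c p)
    (hyz : AcyclicOn D (insert y ((colourClass c W).erase z)))
    (hzX : ∀ X ∈ reachable D c p, X ≠ W → ¬ AcyclicOn D (insert z (colourClass c X)))
    (hy' : y' ∈ unreachableVerts D c p) (hyy' : y' ≠ y)
    (hy'W : AcyclicOn D (insert y' (insert y ((colourClass c W).erase z))))
    {g : V → κ}
    (hg : IsEquitableOn D s ((unreachableVerts D c p).erase y) (reachable D c p)ᶜ g)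
    (hj₀ : j₀ ∉ reachable D c p)
    (hzj : AcyclicOn D (insert z {v ∈ (unreachableVerts D c p).erase y | g v = j₀})) :
    ∃ d : V → κ, IsNearlyEquitable D s p j₀ d ∧ reachable D c p ⊂ reachable D d p := by
  set A := reachable D c p with hA
  have hyA := mem_unreachableVerts.1 hy
  have hpA : p ∈ A := small_mem_reachable
  have hzA : c z ∈ A := hz ▸ hW
  have hzy : z ≠ y := by
    rintro rfl
    exact hyA hzA
  let d : V → κ := fun v =>
    if v = z then j₀ else if v = y then W else if c v ∈ A then c v else g v
  have hdz : d z = j₀ := if_pos rfl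
  have hdy : d y = W := (if_neg hzy.symm).trans (if_pos rfl)
  have hdA : ∀ v, v ≠ z → c v ∈ A → d v = c v := by
    intro v hv hvA
    have hvy : v ≠ y := by
      rintro rfl
      exact hyA hvA
    simp only [d]
    rw [if_neg hv, if_neg hvy, if_pos hvA]
  have hdB : ∀ v, v ≠ y → c v ∉ A → d v = g v := by
    intro v hv hvA
    have hvz : v ≠ z := by
      rintro rfl
      exact hvA hzA
    simp only [d]
    rw [if_neg hvz, if_neg hv, if_neg hvA]
  have hgA : ∀ v, v ≠ y → c v ∉ A → g v ∉ A := fun v hv hvA =>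
    mem_compl.1 (hg.1 v (mem_erase.2 ⟨hv, mem_unreachableVerts.2 hvA⟩))
  have hclsA : ∀ j ∈ A, j ≠ W → colourClass d j = colourClass c j := by
    intro j hj hjW
    ext v
    rw [mem_colourClass, mem_colourClass]
    by_cases hvz : v = z
    · subst hvz
      rw [hdz, hz]
      exact iff_of_false (by rintro rfl; exact hj₀ hj) hjW.symm
    · by_cases hvA : c v ∈ A
      · rw [hdA v hvz hvA]
      · refine iff_of_false ?_ (by rintro rfl; exact hvA hj)
        by_cases hvy : v = y
        · subst hvy
          rw [hdy]
          exact hjW.symm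
        · rw [hdB v hvy hvA]
          rintro rfl
          exact hgA v hvy hvA hj
  have hclsW : colourClass d W = insert y ((colourClass c W).erase z) := by
    ext v
    rw [mem_colourClass, mem_insert, mem_erase, mem_colourClass]
    by_cases hvz : v = z
    · subst hvz
      rw [hdz]
      simp only [hzy, ne_eq, not_true_eq_false, false_and, or_false, iff_false]
      rintro rfl
      exact hj₀ hW
    · by_cases hvy : v = y
      · subst hvy
        simp [hdy]
      · by_cases hvA : c v ∈ A
        · rw [hdA v hvz hvA]
          simp [hvz, hvy]
        · rw [hdB v hvy hvA]
          have h1 : g v ≠ W := by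
            rintro rfl
            exact hgA v hvy hvA hW
          have h2 : c v ≠ W := by
            rintro rfl
            exact hvA hW
          simp [hvy, h1, h2]
  have hclsB : ∀ j ∉ A, ∀ v, d v = j ↔
      (v = z ∧ j = j₀) ∨ v ∈ (unreachableVerts D c p).erase y ∧ g v = j := by
    intro j hj v
    rw [mem_erase, mem_unreachableVerts]
    by_cases hvz : v = z
    · subst hvz
      rw [hdz]
      have : c v ∈ reachable D c p := hzA
      simp [this, eq_comm]
    · by_cases hvy : v = y
      · subst hvy
        rw [hdy]
        simp only [hvz, false_and, ne_eq, not_true_eq_false, or_self, iff_false]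
        rintro rfl
        exact hj hW
      · by_cases hvA : c v ∈ A
        · rw [hdA v hvz hvA]
          have h1 : c v ≠ j := by
            rintro rfl
            exact hj hvA
          have h2 : c v ∈ reachable D c p := hvA
          simp [hvz, h1, h2]
        · rw [hdB v hvy hvA]
          have h2 : c v ∉ reachable D c p := hvA
          simp [hvz, hvy, h2]
  have hclsj₀ : colourClass d j₀ =
      insert z {v ∈ (unreachableVerts D c p).erase y | g v = j₀} := by
    ext v
    rw [mem_colourClass, hclsB j₀ hj₀, mem_insert, mem_filter]
    simp
  have hclsB' : ∀ j ∉ A, j ≠ j₀ →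
      colourClass d j = {v ∈ (unreachableVerts D c p).erase y | g v = j} := by
    intro j hj hjj
    ext v
    rw [mem_colourClass, hclsB j hj, mem_filter]
    simp [hjj]
  have hne : IsNearlyEquitable D s p j₀ d := by
    refine ⟨fun j => ?_, by rintro rfl; exact hj₀ hpA, ?_, ?_, fun j hjp hjj => ?_⟩
    · by_cases hj : j ∈ A
      · by_cases hjW : j = W
        · subst hjW
          rw [hclsW]
          exact hyz
        · rw [hclsA j hj hjW]
          exact hc.acyclic j
      · by_cases hjj : j = j₀
        · subst hjj
          rw [hclsj₀]
          exact hzj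
        · rw [hclsB' j hj hjj]
          exact (hg.2 j (mem_compl.2 hj)).1
    · rw [hclsA p hpA hWp.symm]
      exact hc.card_small
    · rw [hclsj₀, card_insert_of_notMem, (hg.2 j₀ (mem_compl.2 hj₀)).2]
      intro h
      exact mem_unreachableVerts.1 (mem_of_mem_erase (mem_filter.1 h).1) hzA
    · by_cases hj : j ∈ A
      · have hjq : j ≠ q := by
          rintro rfl
          exact hq hj
        by_cases hjW : j = W
        · subst hjW
          rw [hclsW, card_insert_of_notMem, card_erase_add_one (mem_colourClass.2 hz)]
          · exact hc.card_other j hjp hjq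
          · intro h
            exact hyA (mem_colourClass.1 (mem_of_mem_erase h) ▸ hj)
        · rw [hclsA j hj hjW]
          exact hc.card_other j hjp hjq
      · rw [hclsB' j hj hjj]
        exact (hg.2 j (mem_compl.2 hj)).2
  have hreachX : ∀ X ∈ A, X ≠ W → Relation.ReflTransGen (CanMove D d) X p := by
    intro X hX hXW
    refine (hterm X hX hXW).path_mem.lift id ?_
    rintro x x' ⟨⟨hxx', w, hw, hwac⟩, hx, hx'⟩
    obtain ⟨hxW, hxA⟩ := mem_erase.1 hx
    obtain ⟨hx'W, hx'A⟩ := mem_erase.1 hx'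
    have hwz : w ≠ z := by
      rintro rfl
      exact hxW (hw.symm.trans hz)
    refine ⟨hxx', w, ?_, ?_⟩
    · rw [hdA w hwz (hw.symm ▸ hxA)]
      exact hw
    · change AcyclicOn D (insert w (colourClass d x'))
      rwa [hclsA x' hx'A hx'W]
  -- The vertex witnessing the first move on a path from `W` to `p` is not `z`, so it is still
  -- in the new class of `W`.
  have hreachW : Relation.ReflTransGen (CanMove D d) W p := by
    obtain ⟨X, ⟨hWX, w, hw, hwac⟩, hX⟩ :=
      exists_reachesAvoiding_of_reaches (mem_reachSet.1 hW) hWp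
    have hXA : X ∈ A := mem_reachSet.2 hX.reaches
    have hwz : w ≠ z := by
      rintro rfl
      exact hzX X hXA hWX.symm hwac
    refine .head ⟨hWX, w, ?_, ?_⟩ (hreachX X hXA hWX.symm)
    · rw [hdA w hwz (hw.symm ▸ hW)]
      exact hw
    · rwa [hclsA X hXA hWX.symm]
  refine ⟨d, hne, (ssubset_iff_of_subset fun X hX => mem_reachSet.2 ?_).2 ⟨g y', ?_, ?_⟩⟩
  · by_cases hXW : X = W
    · subst hXW
      exact hreachW
    · exact hreachX X hX hXW
  · refine mem_reachSet.2 (.head ⟨?_, y', ?_, ?_⟩ hreachW)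
    · intro h
      exact hgA y' hyy' (mem_unreachableVerts.1 hy') (h ▸ hW)
    · exact hdB y' hyy' (mem_unreachableVerts.1 hy')
    · rw [hclsW]
      exact hy'W
  · exact hgA y' hyy' (mem_unreachableVerts.1 hy')

end Exchange

/-! ### Counting over a maximal set without 2-cycles -/

section FinalCount

variable {V : Type u} {κ : Type v} {D : V → V → Prop}

/-- `z` is the only in-neighbour of `y` in `W`. -/
def IsUniqueIn (D : V → V → Prop) (W : Finset V) (y z : V) : Prop := {w ∈ W | D w y} = {z}

/-- `z` is the only out-neighbour of `y` in `W`. -/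
def IsUniqueOut (D : V → V → Prop) (W : Finset V) (y z : V) : Prop := {w ∈ W | D y w} = {z}

theorem IsUniqueIn.no_in {W : Finset V} {y z : V} (h : IsUniqueIn D W y z) :
    ∀ w ∈ W.erase z, ¬ D w y := by
  intro w hw hwy
  have : w ∈ ({w ∈ W | D w y} : Finset V) := mem_filter.2 ⟨mem_of_mem_erase hw, hwy⟩
  rw [h, mem_singleton] at this
  exact ne_of_mem_erase hw this

theorem IsUniqueOut.no_out {W : Finset V} {y z : V} (h : IsUniqueOut D W y z) :
    ∀ w ∈ W.erase z, ¬ D y w := by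
  intro w hw hwy
  have : w ∈ ({w ∈ W | D y w} : Finset V) := mem_filter.2 ⟨mem_of_mem_erase hw, hwy⟩
  rw [h, mem_singleton] at this
  exact ne_of_mem_erase hw this

/-- Some edge between `y` and `B` is not part of a 2-cycle. -/
def HasLightEdge (D : V → V → Prop) (B : Finset V) (y : V) : Prop :=
  ∃ x ∈ B, (D x y ∧ ¬ D y x) ∨ (D y x ∧ ¬ D x y)

/-- The vertices of `B` which lie on a 2-cycle with `y`. -/
noncomputable def doubleNeighbours (D : V → V → Prop) (B : Finset V) (y : V) : Finset V :=
  {x ∈ B | D x y ∧ D y x}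

theorem two_mul_card_doubleNeighbours_le (B : Finset V) (y : V) :
    2 * #(doubleNeighbours D B y) ≤ degreeTo D y B := by
  have h1 : #(doubleNeighbours D B y) ≤ #{x ∈ B | D x y} :=
    card_le_card (monotone_filter_right _ fun _ _ h => h.1)
  have h2 : #(doubleNeighbours D B y) ≤ #{x ∈ B | D y x} :=
    card_le_card (monotone_filter_right _ fun _ _ h => h.2)
  unfold degreeTo
  omega

theorem HasLightEdge.two_mul_card_lt {B : Finset V} {y : V} (h : HasLightEdge D B y) :
    2 * #(doubleNeighbours D B y) + 1 ≤ degreeTo D y B := by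
  have h1 : doubleNeighbours D B y ⊆ {x ∈ B | D x y} := monotone_filter_right _ fun _ _ h => h.1
  have h2 : doubleNeighbours D B y ⊆ {x ∈ B | D y x} := monotone_filter_right _ fun _ _ h => h.2
  have h1' := card_le_card h1
  have h2' := card_le_card h2
  obtain ⟨x, hx, ⟨hxy, hyx⟩ | ⟨hyx, hxy⟩⟩ := h
  · have := card_lt_card ((ssubset_iff_of_subset h1).2
      ⟨x, mem_filter.2 ⟨hx, hxy⟩, fun h => hyx (mem_filter.1 h).2.2⟩)
    unfold degreeTo
    omega
  · have := card_lt_card ((ssubset_iff_of_subset h2).2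
      ⟨x, mem_filter.2 ⟨hx, hyx⟩, fun h => hxy (mem_filter.1 h).2.1⟩)
    unfold degreeTo
    omega

/-- The number of ways in which `z` serves as a unique neighbour of `y` in `W`, where a vertex `y`
without light edges in `B` claims both ways as soon as it uses one of them. -/
noncomputable def soloWeight (D : V → V → Prop) (B W : Finset V) (y z : V) : ℕ :=
  if HasLightEdge D B y then
    (if IsUniqueIn D W y z then 1 else 0) + (if IsUniqueOut D W y z then 1 else 0)
  else 2 * (if IsUniqueIn D W y z ∨ IsUniqueOut D W y z then 1 else 0)

theorem two_le_card_add_card_unique {W N : Finset V} (hN : N.Nonempty) (hNW : N ⊆ W)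
    {P : V → Prop} (hP : ∀ z, N = {z} → P z) : 2 ≤ #N + #{z ∈ W | P z} := by
  have := card_pos.2 hN
  by_cases h1 : #N = 1
  · obtain ⟨z, rfl⟩ := card_eq_one.1 h1
    have : 0 < #{x ∈ W | P x} :=
      card_pos.2 ⟨z, mem_filter.2 ⟨hNW (mem_singleton_self z), hP z rfl⟩⟩
    omega
  · omega

theorem four_le_sum_soloWeight_add {B W : Finset V} {y : V} (hin : ∃ z ∈ W, D z y)
    (hout : ∃ z ∈ W, D y z) : 4 ≤ ∑ z ∈ W, soloWeight D B W y z + degreeTo D y W := by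
  have hneIn : ({w ∈ W | D w y} : Finset V).Nonempty := by
    obtain ⟨z, hz, h⟩ := hin
    exact ⟨z, mem_filter.2 ⟨hz, h⟩⟩
  have hneOut : ({w ∈ W | D y w} : Finset V).Nonempty := by
    obtain ⟨z, hz, h⟩ := hout
    exact ⟨z, mem_filter.2 ⟨hz, h⟩⟩
  have h1 : 2 ≤ #{w ∈ W | D w y} + #{z ∈ W | IsUniqueIn D W y z} :=
    two_le_card_add_card_unique hneIn (filter_subset _ _) fun _ h => h
  have h2 : 2 ≤ #{w ∈ W | D y w} + #{z ∈ W | IsUniqueOut D W y z} :=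
    two_le_card_add_card_unique hneOut (filter_subset _ _) fun _ h => h
  have h1' := card_pos.2 hneIn
  have h2' := card_pos.2 hneOut
  unfold degreeTo
  by_cases hl : HasLightEdge D B y
  · have e : ∑ z ∈ W, soloWeight D B W y z =
        #{z ∈ W | IsUniqueIn D W y z} + #{z ∈ W | IsUniqueOut D W y z} := by
      rw [card_filter, card_filter, ← sum_add_distrib]
      exact sum_congr rfl fun z _ => if_pos hl
    omega
  · have e : ∑ z ∈ W, soloWeight D B W y z =
        2 * #{z ∈ W | IsUniqueIn D W y z ∨ IsUniqueOut D W y z} := by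
      rw [card_filter, mul_sum]
      exact sum_congr rfl fun z _ => if_neg hl
    have h3 : #{z ∈ W | IsUniqueIn D W y z} ≤
        #{z ∈ W | IsUniqueIn D W y z ∨ IsUniqueOut D W y z} :=
      card_le_card (monotone_filter_right _ fun _ _ h => Or.inl h)
    have h4 : #{z ∈ W | IsUniqueOut D W y z} ≤
        #{z ∈ W | IsUniqueIn D W y z ∨ IsUniqueOut D W y z} :=
      card_le_card (monotone_filter_right _ fun _ _ h => Or.inr h)
    omega

/-- In a set without 2-cycles the vertices of `W` are claimed at most twice, if vertices which
share a unique neighbour are joined as described by the hypotheses. -/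
theorem sum_soloWeight_le_two {B W I : Finset V} {z : V} (hIB : I ⊆ B)
    (hI : ∀ x ∈ I, ∀ y ∈ I, x ≠ y → ¬ (D x y ∧ D y x))
    (hin : ∀ x ∈ I, ∀ y ∈ I, x ≠ y → IsUniqueIn D W x z → IsUniqueIn D W y z → D x y)
    (hout : ∀ x ∈ I, ∀ y ∈ I, x ≠ y → IsUniqueOut D W x z → IsUniqueOut D W y z → D x y)
    (hio : ∀ x ∈ I, ∀ y ∈ I, x ≠ y → IsUniqueIn D W x z → IsUniqueOut D W y z → D y x) :
    ∑ y ∈ I, soloWeight D B W y z ≤ 2 := by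
  have hin' : ∀ x ∈ I, ∀ y ∈ I, IsUniqueIn D W x z → IsUniqueIn D W y z → x = y := by
    intro x hx y hy h1 h2
    by_contra hxy
    exact hI x hx y hy hxy ⟨hin x hx y hy hxy h1 h2, hin y hy x hx (Ne.symm hxy) h2 h1⟩
  have hout' : ∀ x ∈ I, ∀ y ∈ I, IsUniqueOut D W x z → IsUniqueOut D W y z → x = y := by
    intro x hx y hy h1 h2
    by_contra hxy
    exact hI x hx y hy hxy ⟨hout x hx y hy hxy h1 h2, hout y hy x hx (Ne.symm hxy) h2 h1⟩
  by_cases hl : ∀ y ∈ I, IsUniqueIn D W y z ∨ IsUniqueOut D W y z → HasLightEdge D B y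
  · have e : ∑ y ∈ I, soloWeight D B W y z =
        #{y ∈ I | IsUniqueIn D W y z} + #{y ∈ I | IsUniqueOut D W y z} := by
      rw [card_filter, card_filter, ← sum_add_distrib]
      refine sum_congr rfl fun y hy => ?_
      by_cases h : IsUniqueIn D W y z ∨ IsUniqueOut D W y z
      · exact if_pos (hl y hy h)
      · obtain ⟨h1, h2⟩ := not_or.1 h
        simp [soloWeight, h1, h2]
    have h1 : #{y ∈ I | IsUniqueIn D W y z} ≤ 1 := card_le_one.2 fun x hx y hy =>
      hin' x (mem_filter.1 hx).1 y (mem_filter.1 hy).1 (mem_filter.1 hx).2 (mem_filter.1 hy).2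
    have h2 : #{y ∈ I | IsUniqueOut D W y z} ≤ 1 := card_le_one.2 fun x hx y hy =>
      hout' x (mem_filter.1 hx).1 y (mem_filter.1 hy).1 (mem_filter.1 hx).2 (mem_filter.1 hy).2
    omega
  · push Not at hl
    obtain ⟨y₀, hy₀, hsolo, hlight⟩ := hl
    -- An edge of `B` at `y₀` is part of a 2-cycle, so no other vertex of `I` is joined to `y₀`.
    have hno : ∀ y ∈ I, y ≠ y₀ → ¬ D y y₀ ∧ ¬ D y₀ y := by
      intro y hy hne
      have h1 := hI y hy y₀ hy₀ hne
      have h2 : ¬ ((D y y₀ ∧ ¬ D y₀ y) ∨ (D y₀ y ∧ ¬ D y y₀)) :=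
        fun h => hlight ⟨y, hIB hy, h⟩
      tauto
    have hzero : ∀ y ∈ I, y ≠ y₀ → soloWeight D B W y z = 0 := by
      intro y hy hne
      obtain ⟨n1, n2⟩ := hno y hy hne
      have h1 : ¬ IsUniqueIn D W y z := by
        intro h
        rcases hsolo with h' | h'
        · exact hne (hin' y hy y₀ hy₀ h h')
        · exact n2 (hio y hy y₀ hy₀ hne h h')
      have h2 : ¬ IsUniqueOut D W y z := by
        intro h
        rcases hsolo with h' | h'
        · exact n1 (hio y₀ hy₀ y hy hne.symm h' h)
        · exact hne (hout' y hy y₀ hy₀ h h')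
      simp [soloWeight, h1, h2]
    rw [sum_eq_single_of_mem y₀ hy₀ hzero, soloWeight, if_neg hlight, if_pos hsolo]

/-- A maximal set without 2-cycles, together with its neighbours along 2-cycles, covers `B`. -/
theorem exists_maximal_without_doubles (B : Finset V) :
    ∃ I ⊆ B, (∀ x ∈ I, ∀ y ∈ I, x ≠ y → ¬ (D x y ∧ D y x)) ∧
      #B ≤ ∑ y ∈ I, (#(doubleNeighbours D B y) + 1) := by
  obtain ⟨P, hP⟩ : ∃ P : Finset V → Prop, ∀ I, P I ↔
      ∀ x ∈ I, ∀ y ∈ I, x ≠ y → ¬ (D x y ∧ D y x) := ⟨_, fun _ => Iff.rfl⟩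
  have hne : (B.powerset.filter P).Nonempty := ⟨∅, by simp [hP]⟩
  obtain ⟨I, hI, hmax⟩ := exists_max_image _ card hne
  obtain ⟨hIB, hI⟩ := mem_filter.1 hI
  rw [mem_powerset] at hIB
  rw [hP] at hI
  refine ⟨I, hIB, hI, ?_⟩
  have hcover : B ⊆ I.biUnion fun y => insert y (doubleNeighbours D B y) := by
    intro x hx
    rw [mem_biUnion]
    by_contra! hn
    have hxI : x ∉ I := fun h => hn x h (mem_insert_self _ _)
    have hxd : ∀ y ∈ I, ¬ (D x y ∧ D y x) := fun y hy h =>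
      hn y hy (mem_insert_of_mem (mem_filter.2 ⟨hx, h⟩))
    have := hmax (insert x I) (mem_filter.2 ⟨mem_powerset.2 (insert_subset hx hIB), ?_⟩)
    · rw [card_insert_of_notMem hxI] at this
      omega
    · rw [hP]
      intro a ha b hb hab
      rcases mem_insert.1 ha with rfl | ha'
      · rcases mem_insert.1 hb with rfl | hb'
        · exact absurd rfl hab
        · exact hxd b hb'
      · rcases mem_insert.1 hb with rfl | hb'
        · exact fun h => hxd a ha' h.symm
        · exact hI a ha' b hb' hab
  calc #B ≤ _ := card_le_card hcover
    _ ≤ ∑ y ∈ I, #(insert y (doubleNeighbours D B y)) := card_biUnion_le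
    _ ≤ _ := sum_le_sum fun y _ => card_insert_le _ _

/-- The final double count, over a maximal set of vertices of `B` without 2-cycles and the
vertices of the classes in `T` which are unique neighbours of them. -/
theorem false_of_no_exchange {B : Finset V} {T : Finset κ} {cls : κ → Finset V} {s b : ℕ}
    (hB : #B = s * b + 1) (hcls : ∀ W ∈ T, #(cls W) = s) (hbT : b ≤ #T)
    (hin : ∀ y ∈ B, ∀ W ∈ T, ∃ z ∈ cls W, D z y)
    (hout : ∀ y ∈ B, ∀ W ∈ T, ∃ z ∈ cls W, D y z)
    (hdeg : ∀ y ∈ B, ∑ W ∈ T, degreeTo D y (cls W) + degreeTo D y B + 1 ≤ 2 * b + 2 * #T)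
    (hdegB : ∀ y ∈ B, degreeTo D y B + 1 ≤ 2 * b)
    (hii : ∀ W ∈ T, ∀ z ∈ cls W, ∀ x ∈ B, ∀ y ∈ B, x ≠ y →
      IsUniqueIn D (cls W) x z → IsUniqueIn D (cls W) y z → D x y)
    (hoo : ∀ W ∈ T, ∀ z ∈ cls W, ∀ x ∈ B, ∀ y ∈ B, x ≠ y →
      IsUniqueOut D (cls W) x z → IsUniqueOut D (cls W) y z → D x y)
    (hio : ∀ W ∈ T, ∀ z ∈ cls W, ∀ x ∈ B, ∀ y ∈ B, x ≠ y →
      IsUniqueIn D (cls W) x z → IsUniqueOut D (cls W) y z → D y x) : False := by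
  obtain ⟨I, hIB, hI, hcov⟩ := exists_maximal_without_doubles (D := D) B
  have hrow : ∀ y ∈ I, 2 * #T + 2 * (#(doubleNeighbours D B y) + 1) ≤
      ∑ W ∈ T, ∑ z ∈ cls W, soloWeight D B (cls W) y z + 2 * b := by
    intro y hy
    have h1 : ∑ W ∈ T, 4 ≤
        ∑ W ∈ T, (∑ z ∈ cls W, soloWeight D B (cls W) y z + degreeTo D y (cls W)) :=
      sum_le_sum fun W hW =>
        four_le_sum_soloWeight_add (hin y (hIB hy) W hW) (hout y (hIB hy) W hW)
    rw [sum_const, smul_eq_mul, sum_add_distrib] at h1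
    have h2 := hdeg y (hIB hy)
    by_cases hl : HasLightEdge D B y
    · have := hl.two_mul_card_lt
      omega
    · -- Without light edges the sum of the weights is even, so the bound improves by one.
      have h3 := two_mul_card_doubleNeighbours_le (D := D) B y
      have h4 : ∑ W ∈ T, ∑ z ∈ cls W, soloWeight D B (cls W) y z =
          2 * ∑ W ∈ T, ∑ z ∈ cls W,
            (if IsUniqueIn D (cls W) y z ∨ IsUniqueOut D (cls W) y z then 1 else 0) := by
        simp only [mul_sum]
        exact sum_congr rfl fun W _ => sum_congr rfl fun z _ => if_neg hl
      omega
  have hcol : ∑ y ∈ I, ∑ W ∈ T, ∑ z ∈ cls W, soloWeight D B (cls W) y z ≤ 2 * (#T * s) := by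
    rw [sum_comm]
    calc ∑ W ∈ T, ∑ y ∈ I, ∑ z ∈ cls W, soloWeight D B (cls W) y z
        ≤ ∑ W ∈ T, 2 * s := sum_le_sum fun W hW => by
          rw [sum_comm, ← hcls W hW, mul_comm, ← smul_eq_mul, ← sum_const]
          refine sum_le_sum fun z hz => sum_soloWeight_le_two hIB hI ?_ ?_ ?_
          · exact fun x hx y hy => hii W hW z hz x (hIB hx) y (hIB hy)
          · exact fun x hx y hy => hoo W hW z hz x (hIB hx) y (hIB hy)
          · exact fun x hx y hy => hio W hW z hz x (hIB hx) y (hIB hy)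
      _ = 2 * (#T * s) := by
        rw [sum_const, smul_eq_mul]
        ring
  have hsum := sum_le_sum hrow
  rw [sum_add_distrib, sum_add_distrib, sum_const, sum_const, smul_eq_mul, smul_eq_mul,
    ← mul_sum] at hsum
  have hIcard : s * b + 1 ≤ #I * b := by
    rw [← hB, ← smul_eq_mul, ← sum_const]
    refine hcov.trans (sum_le_sum fun y hy => ?_)
    have h1 := hdegB y (hIB hy)
    have h2 := two_mul_card_doubleNeighbours_le (D := D) B y
    omega
  -- Every vertex of `I` covers at most `b` of the `s * b + 1` vertices of `B`.
  have hIs : s + 1 ≤ #I := by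
    by_contra! h
    have : #I * b ≤ s * b := Nat.mul_le_mul_right b (by omega)
    omega
  obtain ⟨e, he⟩ := Nat.exists_eq_add_of_le hbT
  rw [he] at hsum hcol
  have h5 : e * (s + 1) ≤ e * #I := Nat.mul_le_mul_left e hIs
  nlinarith only [hsum, hcol, hcov, hB, h5]

end FinalCount

/-! ### The directed Hajnal–Szemerédi theorem -/

section Main

variable {V : Type u} {κ : Type v} [Fintype V] [Fintype κ] {D : V → V → Prop} {s : ℕ}
  {p q : κ} {c : V → κ}

theorem filter_unreachableVerts {j : κ} (hj : j ∉ reachable D c p) :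
    ({v ∈ unreachableVerts D c p | c v = j} : Finset V) = colourClass c j := by
  ext v
  rw [mem_filter, mem_unreachableVerts, mem_colourClass]
  exact ⟨fun h => h.2, fun h => ⟨h ▸ hj, h⟩⟩

theorem degreeTo_univ_eq (v : V) :
    degreeTo D v univ = ∑ j ∈ reachable D c p, degreeTo D v (colourClass c j) +
      degreeTo D v (unreachableVerts D c p) := by
  rw [degreeTo_filter_eq_sum v univ c univ fun _ _ => mem_univ _,
    degreeTo_filter_eq_sum v (unreachableVerts D c p) c (reachable D c p)ᶜ
      fun w hw => mem_compl.2 (mem_unreachableVerts.1 hw),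
    ← sum_add_sum_compl (reachable D c p)]
  congr 1
  refine sum_congr rfl fun j hj => ?_
  rw [filter_unreachableVerts (mem_compl.1 hj)]
  rfl

theorem IsNearlyEquitable.card_unreachableVerts (hc : IsNearlyEquitable D s p q c)
    (hq : q ∉ reachable D c p) :
    #(unreachableVerts D c p) = s * #(reachable D c p)ᶜ + 1 := by
  have hq' : q ∈ (reachable D c p)ᶜ := mem_compl.2 hq
  rw [card_eq_sum_card_fiberwise (f := c) (t := (reachable D c p)ᶜ)
    fun v hv => mem_compl.2 (mem_unreachableVerts.1 hv)]
  have e : ∀ j ∈ (reachable D c p)ᶜ, #{v ∈ unreachableVerts D c p | c v = j} =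
      s + (if j = q then 1 else 0) := by
    intro j hj
    rw [filter_unreachableVerts (mem_compl.1 hj)]
    by_cases hjq : j = q
    · subst hjq
      simp [hc.card_large]
    · rw [hc.card_other j (by rintro rfl; exact mem_compl.1 hj small_mem_reachable) hjq, if_neg hjq]
      rfl
  rw [sum_congr rfl e, sum_add_distrib, sum_const, smul_eq_mul, sum_ite_eq', if_pos hq', mul_comm]

theorem card_reachable_add_card_compl :
    #(reachable D c p) + #(reachable D c p)ᶜ = Fintype.card κ := card_add_card_compl _

theorem IsNearlyEquitable.degreeTo_unreachableVerts (hc : IsNearlyEquitable D s p q c)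
    (hD : ∀ x, ¬ D x x) (hdeg : ∀ v, degreeTo D v univ + 1 ≤ 2 * Fintype.card κ) {y : V}
    (hy : y ∈ unreachableVerts D c p) :
    degreeTo D y (unreachableVerts D c p) + 1 ≤ 2 * #(reachable D c p)ᶜ := by
  have h1 := two_mul_card_le_sum_degreeTo hD hc.acyclic (v := y) (N := reachable D c p)
    fun X hX => not_acyclicOn_insert_of_unreachable hy hX
  have h2 := degreeTo_univ_eq (D := D) (c := c) (p := p) y
  have h3 := hdeg y
  have h4 := card_reachable_add_card_compl (D := D) (c := c) (p := p)
  omega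

/-- The degree of a vertex of a reachable class `W` which cannot be moved to the classes of `N`. -/
theorem IsNearlyEquitable.degreeTo_add_degreeTo_le (hc : IsNearlyEquitable D s p q c)
    (hD : ∀ x, ¬ D x x) (hdeg : ∀ v, degreeTo D v univ + 1 ≤ 2 * Fintype.card κ) {W : κ}
    (hW : W ∈ reachable D c p) {N : Finset κ} (hNW : N ⊆ (reachable D c p).erase W) {z : V}
    (hN : ∀ X ∈ N, ¬ AcyclicOn D (insert z (colourClass c X))) :
    2 * #N + degreeTo D z (colourClass c W) + degreeTo D z (unreachableVerts D c p) + 1 ≤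
      2 * Fintype.card κ := by
  have h1 := two_mul_card_le_sum_degreeTo hD hc.acyclic hN
  have h2 := degreeTo_univ_eq (D := D) (c := c) (p := p) z
  rw [← add_sum_erase _ _ hW] at h2
  have h3 : ∑ X ∈ N, degreeTo D z (colourClass c X) ≤
      ∑ X ∈ (reachable D c p).erase W, degreeTo D z (colourClass c X) :=
    sum_le_sum_of_subset hNW
  have h4 := hdeg z
  omega

/-- If the solo vertices of a reachable class `W` with at most `s` vertices cannot be moved to
other reachable classes, and all of `W` cannot be moved to at least `a - 1 - t` of the `a`
reachable classes, then `t` exceeds the number of unreachable classes. -/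
theorem IsNearlyEquitable.card_compl_lt (hc : IsNearlyEquitable D s p q c)
    (hq : q ∉ reachable D c p) (hD : ∀ x, ¬ D x x)
    (hdeg : ∀ v, degreeTo D v univ + 1 ≤ 2 * Fintype.card κ) {W : κ} (hW : W ∈ reachable D c p)
    (hWs : #(colourClass c W) ≤ s)
    (hsolo : ∀ z ∈ soloSet D (colourClass c W) (unreachableVerts D c p),
      ∀ X ∈ reachable D c p, X ≠ W → ¬ AcyclicOn D (insert z (colourClass c X)))
    {N : Finset κ} {t : ℕ} (hNW : N ⊆ (reachable D c p).erase W)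
    (hNt : #(reachable D c p) ≤ #N + 1 + t)
    (hN : ∀ z ∈ colourClass c W, ∀ X ∈ N, ¬ AcyclicOn D (insert z (colourClass c X))) :
    #(reachable D c p)ᶜ < t := by
  by_contra! ht
  set b := #(reachable D c p)ᶜ with hb
  have hab : #(reachable D c p) + b = Fintype.card κ := card_reachable_add_card_compl
  have key := four_mul_card_le hD (hc.acyclic W)
    (fun y hy => not_acyclicOn_insert_of_unreachable hy hW) (m := b) (n := b + t)
    (fun z hz => by
      have h1 := hc.degreeTo_add_degreeTo_le hD hdeg hW subset_rfl (z := z) fun X hX =>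
        hsolo z hz X (mem_of_mem_erase hX) (ne_of_mem_erase hX)
      have h2 := card_erase_add_one hW
      omega)
    (fun z hz => by
      have h1 := hc.degreeTo_add_degreeTo_le hD hdeg hW hNW (hN z hz)
      omega)
  rw [hc.card_unreachableVerts hq, ← hb] at key
  have hS : soloSet D (colourClass c W) (unreachableVerts D c p) ⊆ colourClass c W :=
    filter_subset _ _
  have h1 := card_sdiff_add_card_eq_card hS
  have h2 : 2 * (b + t) * #(colourClass c W \ soloSet D (colourClass c W)
      (unreachableVerts D c p)) ≤ 4 * b * #(colourClass c W \ soloSet D (colourClass c W)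
      (unreachableVerts D c p)) := Nat.mul_le_mul_right _ (by omega)
  have h3 : 4 * b * #(colourClass c W) ≤ 4 * b * s := Nat.mul_le_mul_left _ hWs
  rw [← h1, mul_add] at h3
  have h4 : 4 * (s * b + 1) = 4 * b * s + 4 := by ring
  omega

/-- A vertex `z` which can be exchanged for `y` fits into one of the recoloured unreachable
classes. -/
theorem IsNearlyEquitable.exists_insert (hc : IsNearlyEquitable D s p q c) (hD : ∀ x, ¬ D x x)
    (hdeg : ∀ v, degreeTo D v univ + 1 ≤ 2 * Fintype.card κ) {W : κ} {y z : V}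
    (hW : W ∈ reachable D c p) (hz : c z = W) (hy : y ∈ unreachableVerts D c p)
    (hyz : AcyclicOn D (insert y ((colourClass c W).erase z)))
    (hzX : ∀ X ∈ reachable D c p, X ≠ W → ¬ AcyclicOn D (insert z (colourClass c X)))
    {g : V → κ}
    (hg : IsEquitableOn D s ((unreachableVerts D c p).erase y) (reachable D c p)ᶜ g) :
    ∃ j₀ ∉ reachable D c p,
      AcyclicOn D (insert z {v ∈ (unreachableVerts D c p).erase y | g v = j₀}) := by
  by_contra! hcon
  have h1 := hc.degreeTo_add_degreeTo_le hD hdeg hW subset_rfl (z := z) fun X hX =>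
    hzX X (mem_of_mem_erase hX) (ne_of_mem_erase hX)
  have h2 := card_erase_add_one hW
  have h3 : 2 * #(reachable D c p)ᶜ ≤ degreeTo D z ((unreachableVerts D c p).erase y) := by
    rw [degreeTo_filter_eq_sum z _ g _ hg.1, mul_comm, ← smul_eq_mul, ← sum_const]
    exact sum_le_sum fun j hj => two_le_degreeTo_of_not_acyclicOn_insert (hg.2 j hj).1 (hD z)
      (hcon j (mem_compl.1 hj))
  -- All cycles of `W + y` pass through `z`; without these two edges the bound on the degree of `z`
  -- would be too weak to place it.
  have h4 : 2 ≤ degreeTo D z (insert y ((colourClass c W).erase z)) :=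
    two_le_degreeTo_of_exchange (hD z) (mem_colourClass.2 hz)
      (not_acyclicOn_insert_of_unreachable hy hW) hyz
  have hyn : y ∉ (colourClass c W).erase z := by
    intro h
    exact mem_unreachableVerts.1 hy (mem_colourClass.1 (mem_of_mem_erase h) ▸ hW)
  have h5 : degreeTo D z (insert y ((colourClass c W).erase z)) =
      degreeTo D z {y} + degreeTo D z ((colourClass c W).erase z) := by
    rw [insert_eq, degreeTo_union z (disjoint_singleton_left.2 hyn)]
  have h6 : degreeTo D z (unreachableVerts D c p) =
      degreeTo D z {y} + degreeTo D z ((unreachableVerts D c p).erase y) := by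
    rw [← degreeTo_union z (disjoint_singleton_left.2 (notMem_erase _ _)), ← insert_eq,
      insert_erase hy]
  have h7 := degreeTo_mono (D := D) z (erase_subset z (colourClass c W))
  have h8 := card_reachable_add_card_compl (D := D) (c := c) (p := p)
  omega

/-- The step of the Kierstead–Kostochka argument: a nearly equitable colouring whose large class
is not reachable can be made equitable, or replaced by a nearly equitable colouring with more
reachable classes. -/
theorem IsNearlyEquitable.exists_equitable_or_more_reachable (hc : IsNearlyEquitable D s p q c)
    (hq : q ∉ reachable D c p) (hD : ∀ x, ¬ D x x)
    (hdeg : ∀ v, degreeTo D v univ + 1 ≤ 2 * Fintype.card κ)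
    (hsmaller : ∀ (B : Finset V) (C : Finset κ), #C < Fintype.card κ → #B = s * #C →
      (∀ v ∈ B, degreeTo D v B + 1 ≤ 2 * #C) → ∃ g, IsEquitableOn D s B C g) :
    (∃ c' : V → κ, IsEquitable D s c') ∨
      ∃ j₀ d, IsNearlyEquitable D s p j₀ d ∧ reachable D c p ⊂ reachable D d p := by
  by_contra hcon
  obtain ⟨hcon1, hcon2⟩ := not_or.1 hcon
  have hpA : p ∈ reachable D c p := small_mem_reachable
  have hrec : ∀ y ∈ unreachableVerts D c p,
      ∃ g, IsEquitableOn D s ((unreachableVerts D c p).erase y) (reachable D c p)ᶜ g := by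
    intro y hy
    refine hsmaller _ _ ?_ ?_ fun v hv => ?_
    · have := card_pos.2 ⟨p, hpA⟩
      have := card_reachable_add_card_compl (D := D) (c := c) (p := p)
      omega
    · rw [card_erase_of_mem hy, hc.card_unreachableVerts hq]
      rfl
    · have h1 := degreeTo_mono (D := D) v (erase_subset y (unreachableVerts D c p))
      have h2 := hc.degreeTo_unreachableVerts hD hdeg (mem_of_mem_erase hv)
      omega
  -- If only `p` itself were reachable, the count of edges at the small class would fail.
  have hA : 2 ≤ #(reachable D c p) := by
    by_contra! hlt
    have hpW : ∀ X ∈ reachable D c p, X = p := fun X hX =>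
      card_le_one.1 (by omega) X hX p hpA
    have := hc.card_compl_lt hq hD hdeg hpA (by have := hc.card_small; omega)
      (fun z _ X hX hXp => absurd (hpW X hX) hXp) (N := ∅) (t := 0) (empty_subset _)
      (by rw [card_empty]; omega) (fun _ _ _ h => absurd h (notMem_empty _))
    omega
  obtain ⟨U, hU, hTne, hterm⟩ := exists_cutSet_terminal hA
  set T := cutSet (CanMove D c) p U with hT
  have hTA : ∀ W ∈ T, W ∈ reachable D c p := fun W hW => (mem_cutSet.1 hW).1
  have hTp : ∀ W ∈ T, W ≠ p := by
    rintro W hW rfl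
    exact target_notMem_cutSet _ hW
  have hTs : ∀ W ∈ T, #(colourClass c W) = s := fun W hW =>
    hc.card_other W (hTp W hW) (by rintro rfl; exact hq (hTA W hW))
  have hsolo : ∀ W ∈ T, ∀ z ∈ soloSet D (colourClass c W) (unreachableVerts D c p),
      ∀ X ∈ reachable D c p, X ≠ W → ¬ AcyclicOn D (insert z (colourClass c X)) := by
    intro W hW z hz X hX hXW hac
    obtain ⟨hzW, y, hy, hyz⟩ := mem_filter.1 hz
    obtain ⟨g, hg⟩ := hrec y hy
    exact hcon1 (hc.exists_of_move hq (hTA W hW) (mem_colourClass.1 hzW) hy hyz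
      (hterm W hW X hX hXW) hac hg)
  have hbt : #(reachable D c p)ᶜ < #T := by
    obtain ⟨W, hW⟩ := hTne
    have hUT : U ∉ T := fun h => (mem_cutSet.1 h).2.1 rfl
    have hsub : insert U T ⊆ reachable D c p := insert_subset hU hTA
    refine hc.card_compl_lt hq hD hdeg (hTA W hW) (hTs W hW).le (hsolo W hW)
      (N := reachable D c p \ insert U T) (fun X hX => ?_) ?_ fun z hz X hX hac => ?_
    · rw [mem_sdiff, mem_insert, not_or] at hX
      exact mem_erase.2 ⟨by rintro rfl; exact hX.2.2 hW, hX.1⟩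
    · have h1 := card_sdiff_add_card_eq_card hsub
      rw [card_insert_of_notMem hUT] at h1
      omega
    · rw [mem_sdiff, mem_insert, not_or] at hX
      refine hX.2.2 (mem_cutSet_of_rel hW ⟨?_, z, mem_colourClass.1 hz, hac⟩ hX.1 hX.2.1)
      rintro rfl
      exact hX.2.2 hW
  have hswap : ∀ W ∈ T, ∀ z ∈ colourClass c W, ∀ x ∈ unreachableVerts D c p,
      ∀ y ∈ unreachableVerts D c p, x ≠ y → AcyclicOn D (insert y ((colourClass c W).erase z)) →
      ¬ AcyclicOn D (insert x (insert y ((colourClass c W).erase z))) := by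
    intro W hW z hz x hx y hy hxy hyz hac
    obtain ⟨g, hg⟩ := hrec y hy
    have hzX := hsolo W hW z (mem_filter.2 ⟨hz, y, hy, hyz⟩)
    have hzW := mem_colourClass.1 hz
    obtain ⟨j₀, hj₀, hzj⟩ := hc.exists_insert hD hdeg (hTA W hW) hzW hy hyz hzX hg
    obtain ⟨d, hd⟩ := hc.exists_of_exchange hq (hTA W hW) (hTp W hW) (hterm W hW) hzW hy hyz hzX
      hx hxy hac hg hj₀ hzj
    exact hcon2 ⟨j₀, d, hd⟩
  have hclsE : ∀ W z, AcyclicOn D ((colourClass c W).erase z) := fun W z =>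
    (hc.acyclic W).mono (erase_subset _ _)
  refine false_of_no_exchange (D := D) (hc.card_unreachableVerts hq) hTs hbt.le ?_ ?_ ?_
    (fun y hy => hc.degreeTo_unreachableVerts hD hdeg hy) ?_ ?_ ?_
  · exact fun y hy W hW => exists_in_of_not_acyclicOn_insert (hc.acyclic W) (hD y)
      (not_acyclicOn_insert_of_unreachable hy (hTA W hW))
  · exact fun y hy W hW => exists_out_of_not_acyclicOn_insert (hc.acyclic W) (hD y)
      (not_acyclicOn_insert_of_unreachable hy (hTA W hW))
  · intro y hy
    have h1 := degreeTo_univ_eq (D := D) (c := c) (p := p) y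
    rw [← sum_sdiff (show T ⊆ reachable D c p from hTA)] at h1
    have h2 := two_mul_card_le_sum_degreeTo hD hc.acyclic (v := y) (N := reachable D c p \ T)
      fun X hX => not_acyclicOn_insert_of_unreachable hy (mem_sdiff.1 hX).1
    have h3 := card_sdiff_add_card_eq_card (show T ⊆ reachable D c p from hTA)
    have h4 := card_reachable_add_card_compl (D := D) (c := c) (p := p)
    have h5 := hdeg y
    omega
  · intro W hW z hz x hx y hy hxy hxz hyz
    by_contra hn
    have h1 := (hclsE W z).insert_of_no_in (hD x) hxz.no_in
    have h2 := (hclsE W z).insert_of_no_in (hD y) hyz.no_in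
    refine hswap W hW z hz y hy x hx (Ne.symm hxy) h1 (h1.insert_of_no_in (hD y) ?_)
    intro w hw
    rcases mem_insert.1 hw with rfl | hw
    · exact hn
    · exact hyz.no_in w hw
  · intro W hW z hz x hx y hy hxy hxz hyz
    by_contra hn
    have h2 := (hclsE W z).insert_of_no_out (hD y) hyz.no_out
    refine hswap W hW z hz x hx y hy hxy h2 (h2.insert_of_no_out (hD x) ?_)
    intro w hw
    rcases mem_insert.1 hw with rfl | hw
    · exact hn
    · exact hxz.no_out w hw
  · intro W hW z hz x hx y hy hxy hxz hyz
    by_contra hn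
    have h2 := (hclsE W z).insert_of_no_out (hD y) hyz.no_out
    refine hswap W hW z hz x hx y hy hxy h2 (h2.insert_of_no_in (hD x) ?_)
    intro w hw
    rcases mem_insert.1 hw with rfl | hw
    · exact hn
    · exact hxz.no_in w hw

/-- Under the degree condition, a nearly equitable colouring yields an equitable one. -/
theorem IsNearlyEquitable.exists_equitable (hc : IsNearlyEquitable D s p q c)
    (hD : ∀ x, ¬ D x x) (hdeg : ∀ v, degreeTo D v univ + 1 ≤ 2 * Fintype.card κ)
    (hsmaller : ∀ (B : Finset V) (C : Finset κ), #C < Fintype.card κ → #B = s * #C →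
      (∀ v ∈ B, degreeTo D v B + 1 ≤ 2 * #C) → ∃ g, IsEquitableOn D s B C g) :
    ∃ c' : V → κ, IsEquitable D s c' := by
  induction hn : #(reachable D c p)ᶜ using Nat.strong_induction_on generalizing c q with
  | _ n ih =>
    by_cases hq : q ∈ reachable D c p
    · exact hc.exists_of_large_mem hq
    · rcases hc.exists_equitable_or_more_reachable hq hD hdeg hsmaller with h | ⟨j₀, d, hd, hlt⟩
      · exact h
      · refine ih _ ?_ hd rfl
        rw [← hn]
        exact card_lt_card (compl_ssubset_compl.2 hlt)

theorem exists_degreeTo_colourClass_le_one [Nonempty κ] (c : V → κ) (u : V)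
    (h : degreeTo D u univ + 1 ≤ 2 * Fintype.card κ) :
    ∃ j, degreeTo D u (colourClass c j) ≤ 1 := by
  by_contra! hn
  have h1 : ∑ j : κ, 2 ≤ ∑ j : κ, degreeTo D u (colourClass c j) := sum_le_sum fun j _ => hn j
  have h2 : degreeTo D u univ = ∑ j : κ, degreeTo D u (colourClass c j) :=
    degreeTo_filter_eq_sum u univ c univ fun _ _ => mem_univ _
  rw [sum_const, smul_eq_mul, card_univ] at h1
  omega

/-- The directed Hajnal–Szemerédi theorem, in complementary form: a digraph on `s * k` vertices
with all total degrees at most `2 * k - 1` has a partition into `k` acyclic sets of `s` vertices.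
The colours are arbitrary so that the induction on `k` can pass to a subset of the colours, and
the edges of the digraph are restored one vertex at a time. -/
theorem exists_isEquitable (s n : ℕ) : ∀ (V : Type u) (κ : Type v) [Fintype V] [Fintype κ]
    (D : V → V → Prop), Fintype.card κ = n → Fintype.card V = s * n → (∀ x, ¬ D x x) →
    (∀ v, degreeTo D v univ + 1 ≤ 2 * n) → ∃ c : V → κ, IsEquitable D s c := by
  induction n using Nat.strong_induction_on with
  | _ n ih =>
    intro V κ _ _ D hκ hV hD hdeg
    subst hκ
    -- Only the edges inside `U` are present.
    have main : ∀ U : Finset V, ∃ c : V → κ, IsEquitable (restrictTo D U) s c := by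
      intro U
      induction U using Finset.induction_on with
      | empty =>
        obtain ⟨e⟩ : Nonempty (V ≃ κ × Fin s) := by
          refine ⟨Fintype.equivOfCardEq ?_⟩
          rw [hV, Fintype.card_prod, Fintype.card_fin, mul_comm]
        refine ⟨fun v => (e v).1, fun j => ⟨fun T _ hne => ?_, ?_⟩⟩
        · obtain ⟨v, hv⟩ := hne
          exact ⟨v, hv, fun w _ h => absurd h.2.1 (notMem_empty _)⟩
        · have e' : colourClass (fun v => (e v).1) j =
              (univ : Finset (Fin s)).image fun i => e.symm (j, i) := by
            ext v
            simp only [mem_colourClass, mem_image, mem_univ, true_and]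
            constructor
            · rintro rfl
              exact ⟨(e v).2, by simp⟩
            · rintro ⟨i, rfl⟩
              simp
          rw [e', card_image_of_injective _ fun a b h => by simpa using h, card_univ,
            Fintype.card_fin]
      | insert u U huU ihU =>
        obtain ⟨c, hc⟩ := ihU
        have hle : ∀ x y, restrictTo D (insert u U) x y → D x y := fun x y h => h.1
        have hdeg' : ∀ v, degreeTo (restrictTo D (insert u U)) v univ + 1 ≤ 2 * Fintype.card κ :=
          fun v => (Nat.add_le_add_right (degreeTo_le_of_imp hle v univ) 1).trans (hdeg v)
        have hD' : ∀ x, ¬ restrictTo D (insert u U) x x := fun x h => hD x h.1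
        have hκ : Nonempty κ := ⟨c u⟩
        have hsame : ∀ S : Finset V, u ∉ S → AcyclicOn (restrictTo D U) S →
            AcyclicOn (restrictTo D (insert u U)) S := by
          refine fun S hS hac => hac.anti fun x hx y hy h => ⟨h.1, ?_, ?_⟩
          · exact (mem_insert.1 h.2.1).resolve_left (by rintro rfl; exact hS hx)
          · exact (mem_insert.1 h.2.2).resolve_left (by rintro rfl; exact hS hy)
        obtain ⟨W, hW⟩ := exists_degreeTo_colourClass_le_one c u (hdeg' u)
        have hacW : AcyclicOn (restrictTo D (insert u U)) (insert u ((colourClass c W).erase u)) := by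
          by_contra hn
          have h1 := two_le_degreeTo_of_not_acyclicOn_insert
            (hsame _ (notMem_erase _ _) ((hc W).1.mono (erase_subset _ _))) (hD' u) hn
          have h2 := degreeTo_mono (D := restrictTo D (insert u U)) u
            (erase_subset u (colourClass c W))
          omega
        have hac : ∀ j, AcyclicOn (restrictTo D (insert u U))
            (colourClass (Function.update c u W) j) := by
          intro j
          by_cases hj : j = W
          · subst hj
            have e : insert u (colourClass c j) = insert u ((colourClass c j).erase u) := by
              ext x
              by_cases hx : x = u <;> simp [hx]
            rw [colourClass_update_self, e]
            exact hacW
          · rw [colourClass_update_of_ne c u hj]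
            exact hsame _ (notMem_erase _ _) ((hc j).1.mono (erase_subset _ _))
        have hcard := card_colourClass_update c u W
        by_cases hWu : W = c u
        · refine ⟨Function.update c u W, fun j => ⟨hac j, ?_⟩⟩
          have := hcard j
          rw [hWu, (hc j).2] at this
          rw [hWu]
          omega
        · have hne : IsNearlyEquitable (restrictTo D (insert u U)) s (c u) W
              (Function.update c u W) := by
            refine ⟨hac, Ne.symm hWu, ?_, ?_, fun j hj1 hj2 => ?_⟩
            · have := hcard (c u)
              rwa [(hc _).2, if_pos rfl, if_neg (Ne.symm hWu)] at this
            · have := hcard W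
              rwa [(hc _).2, if_pos rfl, if_neg hWu] at this
            · have := hcard j
              rwa [(hc _).2, if_neg hj1, if_neg hj2] at this
          refine hne.exists_equitable hD' hdeg' fun B C hC hB hBdeg => ?_
          obtain ⟨g, hg⟩ := ih #C hC B C (fun x y => restrictTo D (insert u U) x y)
            (Fintype.card_coe C) ((Fintype.card_coe B).trans hB) (fun x => hD' x) fun v => by
              rw [degreeTo_subtype_univ]
              exact hBdeg v v.2
          exact ⟨_, IsEquitableOn.of_subtype (i₀ := c u) hg⟩
    obtain ⟨c, hc⟩ := main univ
    exact ⟨c, fun j => ⟨(hc j).1.anti fun x _ y _ h => ⟨h, mem_univ x, mem_univ y⟩, (hc j).2⟩⟩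

end Main

theorem ncard_eq_card {V : Type u} {S : Set V} {X : Finset V} (h : ∀ w, w ∈ S ↔ w ∈ X) :
    S.ncard = #X := by
  rw [← Set.ncard_coe_finset]
  congr 1
  ext w
  exact h w

/-! ### From acyclic colourings to transitive tournaments -/

section Tiles

variable {V : Type u} {G : Digraph V}

/-- The non-edges of `G`, reversed. The acyclic sets of this relation are those on which `G`
contains a transitive tournament. -/
def reverseComplement (G : Digraph V) : V → V → Prop := fun v w => v ≠ w ∧ ¬ G.Adj w v

theorem exists_transitive_tile {S : Finset V} {s : ℕ} (hS : AcyclicOn (reverseComplement G) S)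
    (hs : #S = s) : ∃ T : G.Subgraph, T.verts = S ∧
      T.coe.IsIsomorphic (Digraph.transitiveTournament s) := by
  obtain ⟨l, hl, hmem, hp⟩ := hS.exists_list
  have hlen : l.length = s := by
    rw [← hs, ← List.toFinset_card_of_nodup hl]
    congr 1
    ext x
    rw [List.mem_toFinset, hmem]
  subst hlen
  have hadj : ∀ i j : Fin l.length, i < j → G.Adj (l.get i) (l.get j) := by
    intro i j hij
    have h := List.pairwise_iff_get.1 hp i j hij
    by_contra hn
    refine h ⟨fun he => ?_, hn⟩
    exact hij.ne (List.nodup_iff_injective_get.1 hl he).symm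
  have hget : ∀ i : Fin l.length, l.get i ∈ S := fun i => (hmem _).1 (List.get_mem l i)
  let T : G.Subgraph :=
    { verts := S
      Adj := fun v w => ∃ i j : Fin l.length, i < j ∧ l.get i = v ∧ l.get j = w
      adj_sub := by
        rintro v w ⟨i, j, hij, rfl, rfl⟩
        exact hadj i j hij
      fst_mem := by
        rintro v w ⟨i, j, hij, rfl, rfl⟩
        exact hget i
      snd_mem := by
        rintro v w ⟨i, j, hij, rfl, rfl⟩
        exact hget j }
  have hbij : Function.Bijective fun i : Fin l.length => (⟨l.get i, hget i⟩ : T.verts) := by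
    constructor
    · intro i j h
      exact List.nodup_iff_injective_get.1 hl (Subtype.ext_iff.1 h)
    · rintro ⟨v, hv⟩
      obtain ⟨i, hi⟩ := List.get_of_mem ((hmem v).2 hv)
      exact ⟨i, Subtype.ext hi⟩
  refine ⟨T, rfl, ⟨RelIso.symm ⟨Equiv.ofBijective _ hbij, ?_⟩⟩⟩
  intro i j
  constructor
  · rintro ⟨i', j', hij, hi, hj⟩
    have hi' := List.nodup_iff_injective_get.1 hl hi
    have hj' := List.nodup_iff_injective_get.1 hl hj
    subst hi' hj'
    exact hij
  · exact fun h => ⟨i, j, h, rfl, rfl⟩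

theorem exists_factor_of_isEquitable [Fintype V] {s k : ℕ} (hs : 1 ≤ s) {c : V → Fin k}
    (hc : IsEquitable (reverseComplement G) s c) :
    ∃ F : Set G.Subgraph, G.IsFactorOf (Digraph.transitiveTournament s) F ∧ F.ncard = k := by
  choose T hT hiso using fun j => exists_transitive_tile (hc j).1 (hc j).2
  have hmem : ∀ j v, v ∈ (T j).verts ↔ c v = j := by
    intro j v
    rw [hT, mem_coe, mem_colourClass]
  have hinj : Function.Injective T := by
    intro i j hij
    obtain ⟨v, hv⟩ := card_pos.1 (show 0 < #(colourClass c i) by rw [(hc i).2]; exact hs)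
    rw [mem_colourClass] at hv
    have := (hmem i v).2 hv
    rw [hij, hmem] at this
    exact hv.symm.trans this
  refine ⟨Set.range T, ⟨⟨?_, fun v => ⟨T (c v), ⟨c v, rfl⟩, (hmem _ v).2 rfl⟩⟩, ?_⟩, ?_⟩
  · rintro _ ⟨i, rfl⟩ _ ⟨j, rfl⟩ hij
    refine Set.disjoint_left.2 fun v hvi hvj => hij ?_
    rw [← (hmem i v).1 hvi, ← (hmem j v).1 hvj]
  · rintro _ ⟨j, rfl⟩
    exact hiso j
  · rw [← Set.image_univ, Set.ncard_image_of_injective _ hinj, Set.ncard_univ,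
      Nat.card_eq_fintype_card, Fintype.card_fin]

/-- Every pair of distinct vertices contributes two to the degrees of `G` and its complement, and
there are `n - 1` such pairs at each vertex. -/
theorem degreeTo_reverseComplement_add [Fintype V] (hG : G.IsSimple) (v : V) :
    degreeTo (reverseComplement G) v univ + G.totalDegree v + 2 = 2 * Fintype.card V := by
  have key : ∀ P : V → Prop, ¬ P v → #{w : V | w ≠ v ∧ ¬ P w} + #{w : V | P w} + 1 =
      Fintype.card V := by
    intro P hP
    have h1 : ({w : V | w ≠ v ∧ ¬ P w} : Finset V) = ({w : V | ¬ P w} : Finset V).erase v := by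
      ext w
      simp
    have h2 : v ∈ ({w : V | ¬ P w} : Finset V) := by simpa using hP
    rw [h1, add_right_comm, card_erase_add_one h2, add_comm, card_filter_add_card_filter_not,
      card_univ]
  have h1 := key (fun w => G.Adj v w) (hG v)
  have h2 := key (fun w => G.Adj w v) (hG v)
  have h3 : #{w : V | reverseComplement G v w} = #{w : V | w ≠ v ∧ ¬ G.Adj w v} := by
    refine congrArg card (filter_congr fun w _ => ?_)
    rw [reverseComplement, ne_comm]
  have h4 : #{w : V | reverseComplement G w v} = #{w : V | w ≠ v ∧ ¬ G.Adj v w} :=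
    congrArg card (filter_congr fun w _ => Iff.rfl)
  have h5 : G.outDegree v = #{w : V | G.Adj v w} := ncard_eq_card fun w => by simp
  have h6 : G.inDegree v = #{w : V | G.Adj w v} := ncard_eq_card fun w => by simp
  rw [degreeTo, Digraph.totalDegree, h3, h4, h5, h6]
  omega

end Tiles

/-! ### Optimality of the degree bound -/

section Sharpness

/-- The digraph on `Fin n` with all edges except those inside the set of the first `m` vertices. -/
def splitDigraph (n m : ℕ) : Digraph (Fin n) where
  Adj v w := v ≠ w ∧ ¬ (v.val < m ∧ w.val < m)

theorem card_filter_val_lt {n m : ℕ} (h : m ≤ n) : #{w : Fin n | w.val < m} = m := by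
  rw [Fin.card_filter_val_lt]
  exact min_eq_right h

theorem totalDegree_splitDigraph_eq {n m : ℕ} (h : m ≤ n) {v : Fin n} (hv : v.val < m) :
    (splitDigraph n m).totalDegree v = 2 * (n - m) := by
  have key : #{w : Fin n | ¬ w.val < m} = n - m := by
    have := card_filter_add_card_filter_not (s := (univ : Finset (Fin n))) fun w => w.val < m
    rw [card_filter_val_lt h, card_univ, Fintype.card_fin] at this
    omega
  have h1 : (splitDigraph n m).outDegree v = #{w : Fin n | ¬ w.val < m} :=
    ncard_eq_card fun w => by
      rw [mem_filter_univ]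
      exact ⟨fun h hw => h.2 ⟨hv, hw⟩, fun hw => ⟨by rintro rfl; exact hw hv, fun h => hw h.2⟩⟩
  have h2 : (splitDigraph n m).inDegree v = #{w : Fin n | ¬ w.val < m} :=
    ncard_eq_card fun w => by
      rw [mem_filter_univ]
      exact ⟨fun h hw => h.2 ⟨hw, hv⟩, fun hw => ⟨by rintro rfl; exact hw hv, fun h => hw h.1⟩⟩
  rw [Digraph.totalDegree, h1, h2, key]
  omega

theorem le_totalDegree_splitDigraph {n m : ℕ} (h : m ≤ n) (hm : 1 ≤ m) (v : Fin n) :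
    2 * (n - m) ≤ (splitDigraph n m).totalDegree v := by
  by_cases hv : v.val < m
  · exact (totalDegree_splitDigraph_eq h hv).ge
  · have key : #((univ : Finset (Fin n)).erase v) = n - 1 := by
      rw [card_erase_of_mem (mem_univ v), card_univ, Fintype.card_fin]
    have h1 : (splitDigraph n m).outDegree v = #((univ : Finset (Fin n)).erase v) :=
      ncard_eq_card fun w => by
        rw [mem_erase]
        exact ⟨fun h => ⟨h.1.symm, mem_univ w⟩, fun h => ⟨h.1.symm, fun h' => hv h'.1⟩⟩
    have h2 : (splitDigraph n m).inDegree v = #((univ : Finset (Fin n)).erase v) :=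
      ncard_eq_card fun w => by
        rw [mem_erase]
        exact ⟨fun h => ⟨h.1, mem_univ w⟩, fun h => ⟨h.1, fun h' => hv h'.2⟩⟩
    rw [Digraph.totalDegree, h1, h2, key]
    omega

theorem minTotalDegree_splitDigraph {n m : ℕ} (h : m ≤ n) (hm : 1 ≤ m) :
    (splitDigraph n m).minTotalDegree = 2 * (n - m) := by
  have : Nonempty (Fin n) := ⟨⟨0, by omega⟩⟩
  refine le_antisymm ?_ (le_ciInf (le_totalDegree_splitDigraph h hm))
  rw [← totalDegree_splitDigraph_eq h (v := ⟨0, by omega⟩) hm]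
  exact ciInf_le' _ _

/-- A tournament meets the independent set of the first `m` vertices at most once, and a factor
with tiles of `s` vertices has only `k < m` tiles. -/
theorem not_exists_tournament_factor {n s k m : ℕ} (hn : n = s * k) (hs : 1 ≤ s) (hm : m ≤ n) (hkm : k < m) :
    ¬ ∃ F : Set (splitDigraph n m).Subgraph, (splitDigraph n m).IsFactor F ∧
      ∀ T ∈ F, T.verts.ncard = s ∧ T.coe.IsTournament := by
  rintro ⟨F, ⟨hdis, hcov⟩, hF⟩
  choose τ hτF hτ using hcov
  have hτeq : ∀ v T, T ∈ F → v ∈ T.verts → τ v = T := by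
    intro v T hT hv
    by_contra hne
    exact Set.disjoint_left.1 (hdis (hτF v) hT hne) (hτ v) hv
  have hfib : ∀ T ∈ univ.image τ, #{v | τ v = T} = s := by
    intro T hT
    obtain ⟨w, -, rfl⟩ := mem_image.1 hT
    refine (ncard_eq_card fun v => ?_).symm.trans (hF _ (hτF w)).1
    rw [mem_filter_univ]
    exact ⟨hτeq v _ (hτF w), fun h => h ▸ hτ v⟩
  have hcard := card_eq_sum_card_image τ univ
  rw [sum_congr rfl hfib, sum_const, smul_eq_mul, card_univ, Fintype.card_fin] at hcard
  have hk : k = #(univ.image τ) := 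
    Nat.eq_of_mul_eq_mul_right hs (by rw [← hcard, hn, mul_comm])
  have hinj : Set.InjOn τ ({v : Fin n | v.val < m} : Finset (Fin n)) := by
    intro v hv w hw hvw
    by_contra hne
    have hv' : v.val < m := by simpa using hv
    have hw' : w.val < m := by simpa using hw
    have hwT : w ∈ (τ v).verts := hvw ▸ hτ w
    rcases ((hF _ (hτF v)).2.2 ⟨v, hτ v⟩ ⟨w, hwT⟩ fun h => hne (Subtype.ext_iff.1 h)) with
      ⟨h, -⟩ | ⟨h, -⟩
    · exact ((τ v).adj_sub h).2 ⟨hv', hw'⟩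
    · exact ((τ v).adj_sub h).2 ⟨hw', hv'⟩
  have h1 := card_le_card (image_subset_image (f := τ)
    (subset_univ ({v : Fin n | v.val < m} : Finset (Fin n))))
  rw [card_image_of_injOn hinj, card_filter_val_lt hm] at h1
  omega

theorem isTournament_of_isIsomorphic {W : Type u} {H : Digraph W} {s : ℕ}
    (h : H.IsIsomorphic (Digraph.transitiveTournament s)) : Nat.card W = s ∧ H.IsTournament := by
  obtain ⟨e⟩ := h
  refine ⟨by rw [Nat.card_congr e.toEquiv, Nat.card_eq_fintype_card, Fintype.card_fin],
    fun v hv => lt_irrefl _ (e.map_rel_iff.2 hv), fun v w hvw => ?_⟩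
  have hne : e v ≠ e w := fun h => hvw (e.injective h)
  have h1 : H.Adj v w ↔ e v < e w := e.map_rel_iff.symm
  have h2 : H.Adj w v ↔ e w < e v := e.map_rel_iff.symm
  rw [h1, h2]
  rcases lt_or_gt_of_ne hne with h | h
  · exact Or.inl ⟨h, h.asymm⟩
  · exact Or.inr ⟨h, h.asymm⟩

end Sharpness

end EquitableAcyclic

theorem theorem7 (s k : ℕ) (hs : 1 ≤ s) :
    (∀ (V : Type*) [Fintype V] (G : Digraph V), G.IsSimple → Fintype.card V = s * k →
      2 * (1 - 1 / (s : ℝ)) * (Fintype.card V : ℝ) - 1 ≤ (G.minTotalDegree : ℝ) →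
        ∃ F : Set G.Subgraph,
          G.IsFactorOf (Digraph.transitiveTournament s) F ∧ F.ncard = k) ∧
    (2 ≤ s → 1 ≤ k →
      ∃ G : Digraph (Fin (s * k)), G.IsSimple ∧
        (G.minTotalDegree : ℝ) = 2 * (1 - 1 / (s : ℝ)) * ((s * k : ℕ) : ℝ) - 2 ∧
        (¬ ∃ F : Set G.Subgraph, G.IsFactorOf (Digraph.transitiveTournament s) F) ∧
        ¬ ∃ F : Set G.Subgraph, G.IsFactor F ∧
          ∀ T ∈ F, T.verts.ncard = s ∧ T.coe.IsTournament) := by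
  have hs0 : (s : ℝ) ≠ 0 := by positivity
  have hbound : 2 * (1 - 1 / (s : ℝ)) * ((s * k : ℕ) : ℝ) = 2 * s * k - 2 * k := by
    push_cast
    field_simp
  refine ⟨fun V _ G hG hV hdeg => ?_, fun hs2 hk => ?_⟩
  · rw [hV, hbound] at hdeg
    obtain ⟨c, hc⟩ := EquitableAcyclic.exists_isEquitable s k V (Fin k)
      (EquitableAcyclic.reverseComplement G) (Fintype.card_fin k) hV (fun x h => h.1 rfl)
      fun v => by
        have h1 := EquitableAcyclic.degreeTo_reverseComplement_add hG v
        have h2 : G.minTotalDegree ≤ G.totalDegree v := ciInf_le' _ _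
        have h3 : 2 * (s * k) ≤ 2 * k + 1 + G.minTotalDegree := by
          have : (2 * (s * k) : ℝ) ≤ 2 * k + 1 + G.minTotalDegree := by linarith
          exact_mod_cast this
        rw [hV] at h1
        omega
    exact EquitableAcyclic.exists_factor_of_isEquitable hs hc
  · have hle : k + 1 ≤ s * k := by nlinarith
    have hno := EquitableAcyclic.not_exists_tournament_factor rfl hs hle (Nat.lt_succ_self k)
    refine ⟨EquitableAcyclic.splitDigraph (s * k) (k + 1), fun v h => h.1 rfl, ?_, ?_, hno⟩
    · rw [EquitableAcyclic.minTotalDegree_splitDigraph hle (by omega), hbound]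
      push_cast [Nat.cast_sub hle]
      ring
    · rintro ⟨F, hF, hiso⟩
      exact hno ⟨F, hF, fun T hT => EquitableAcyclic.isTournament_of_isIsomorphic (hiso T hT)⟩
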